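/- An ai-semiring is an algebra $(S,+,\cdot)$ in which $+$ is associative, commutative and idempotent, $\cdot$ is associative, and $\cdot$ distributes over $+$ on both sides; a variety of ai-semirings is a class of ai-semirings closed under homomorphic images, subalgebras and direct products. Let $S_c(abc)$ be the commutative ai-semiring whose elements are the nonempty subwords of the word $abc$ ($a,b,c$ distinct letters) in the free commutative semigroup together with a new element $0$, where $\mathbf u\cdot\mathbf v$ is the word $\mathbf u\mathbf v$ if it is a subword of $abc$ and $0$ otherwise, $x+x=x$, and $x+y=0$ for $x\ne y$. A $3$-uniform hypergraph $\mathbb H=\langle V,E\rangle$ consists of a finite set $V$ and a set $E$ of $3$-element subsets of $V$ (the hyperedges). It is $2$-colourable if there is $\varphi:V\to\{0,1\}$ with $|\varphi(e)|=2$ for all $e\in E$. A cycle of length $m\ge 2$ is a sequence $v_1,e_1,v_2,e_2,\dots,v_m,e_m$ of distinct vertices $v_i$ and distinct hyperedges $e_i$ with $v_i,v_{i+1}\in e_i$ (indices modulo $m$); the girth is the least length of a cycle ($\infty$ if there is none). If $E\neq\varnothing$, let $\mathbf t_{\mathbb H}$ be the sum of all products $x_{v_1}x_{v_2}x_{v_3}$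 with $\{v_1,v_2,v_3\}\in E$ (all six orders of each hyperedge), a term in the variables $\{x_v\mid v\in V\}$. For $\mathbb H$ of girth at least $5$, let $S_{\mathbb H}$ be the ai-semiring whose multiplicative semigroup is generated by elements $\mathbf a_v$ $(v\in V)$ and $\infty$ subject to: $\infty$ is a multiplicative zero; $\mathbf a_u\mathbf a_v=\mathbf a_v\mathbf a_u$; $\mathbf a_u\mathbf a_v=\infty$ if $\{u,v\}$ is not a $2$-element subset of a hyperedge; $\mathbf a_{u_1}\mathbf a_{u_2}\mathbf a_{u_3}=\mathbf a_{v_1}\mathbf a_{v_2}\mathbf a_{v_3}$ if $\{u_1,u_2,u_3\},\{v_1,v_2,v_3\}\in E$; $\mathbf a_{u_1}\mathbf a_{u_2}=\mathbf a_{v_1}\mathbf a_{v_2}$ if $\{u_1,u_2,\omega\},\{v_1,v_2,\omega\}\in E$ for some $\omega\in V$; and whose addition is $x+x=x$, $x+y=\infty$ for $x\neq y$. Let $\mathbf a\in S_{\mathbb H}$ be the common value of the products $\mathbf a_{v_1}\mathbf a_{v_2}\mathbf a_{v_3}$ with $\{v_1,v_2,v_3\}\in E$. A non-hyperedge term for $\mathbb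 H$ is an ai-semiring term in the variables $\{x_v\mid v\in V\}$ whose value in $S_{\mathbb H}$ under $x_v\mapsto\mathbf a_v$ is not $\mathbf a$. Theorem. For each $n\ge 2$ let $\mathbb H_n$ be a $3$-uniform hypergraph that is not $2$-colourable and has girth greater than $3\binom{3n}{2}$, and let $\mathbf w_n$ be a non-hyperedge term for $\mathbb H_n$. Let $\mathcal V$ be a variety of ai-semirings that contains $S_c(abc)$ and satisfies the identity $$\mathbf t_{\mathbb H_n}\approx\mathbf t_{\mathbb H_n}+\mathbf w_n$$ for all $n\ge 2$. Then $\mathcal V$ is nonfinitely based: there is no finite set of identities $\Gamma$ such that the identities of $\mathcal V$ are exactly the identities that hold in every ai-semiring satisfying $\Gamma$. -/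

import Mathlib

universe u v

/-! ### Additively idempotent semirings, terms, identities, varieties -/

/-- An additively idempotent semiring: `+` is commutative, associative and idempotent,
`*` is associative, and `*` distributes over `+` on both sides. No `0` or `1` is required. -/
class AiSemiring (S : Type u) extends AddCommSemigroup S, Semigroup S, Distrib S where
  add_idem : ∀ x : S, x + x = x

/-- Terms in the signature `{+, *}` over a set `X` of variables. -/
inductive AiTerm (X : Type v) : Type v
  | var : X → AiTerm X
  | add : AiTerm X → AiTerm X → AiTerm X
  | mul : AiTerm X → AiTerm X → AiTerm X

namespace AiTerm

/-- The value of a term under an assignment `f` of its variables. -/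
def eval {X : Type v} {S : Type u} [Add S] [Mul S] (f : X → S) : AiTerm X → S
  | var x => f x
  | add p q => eval f p + eval f q
  | mul p q => eval f p * eval f q

/-- The formal sum of a nonempty list of terms. -/
def sum {X : Type v} : (l : List (AiTerm X)) → l ≠ [] → AiTerm X
  | [], h => absurd rfl h
  | [p], _ => p
  | p :: q :: l, _ => add p (sum (q :: l) (List.cons_ne_nil q l))

end AiTerm

/-- `S` satisfies the identity `p ≈ q`. -/
def Satisfies (S : Type u) [Add S] [Mul S] {X : Type v} (p q : AiTerm X) : Prop :=
  ∀ f : X → S, p.eval f = q.eval f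

/-- `f` is a homomorphism of ai-semirings. -/
def IsAiHom {S T : Type u} [AiSemiring S] [AiSemiring T] (f : S → T) : Prop :=
  (∀ x y, f (x + y) = f x + f y) ∧ ∀ x y, f (x * y) = f x * f y

/-- The direct product of ai-semirings. -/
instance Pi.aiSemiring {I : Type u} (S : I → Type u) [∀ i, AiSemiring (S i)] :
    AiSemiring (∀ i, S i) where
  add_assoc x y z := funext fun i => add_assoc (x i) (y i) (z i)
  add_comm x y := funext fun i => add_comm (x i) (y i)
  mul_assoc x y z := funext fun i => mul_assoc (x i) (y i) (z i)
  left_distrib x y z := funext fun i => left_distrib (x i) (y i) (z i)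
  right_distrib x y z := funext fun i => right_distrib (x i) (y i) (z i)
  add_idem x := funext fun i => AiSemiring.add_idem (x i)

/-- A class `K` of ai-semirings is a variety if it is closed under homomorphic images,
(isomorphic copies of nonempty) subalgebras, and direct products. -/
structure IsAiVariety (K : (S : Type u) → [AiSemiring S] → Prop) : Prop where
  hom_image : ∀ (S T : Type u) [AiSemiring S] [AiSemiring T] (f : S → T),
    IsAiHom f → Function.Surjective f → K S → K T
  subalgebra : ∀ (S T : Type u) [AiSemiring S] [AiSemiring T] [Nonempty S] (f : S → T),
    IsAiHom f → Function.Injective f → K T → K S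
  product : ∀ (I : Type u) (S : I → Type u) [∀ i, AiSemiring (S i)],
    (∀ i, K (S i)) → K (∀ i, S i)

/-- The class `K` satisfies the identity `p ≈ q`. -/
def ClassSatisfies (K : (S : Type u) → [AiSemiring S] → Prop) {X : Type v}
    (p q : AiTerm X) : Prop :=
  ∀ (S : Type u) [AiSemiring S], K S → Satisfies S p q

/-- `K` is finitely based: there is a finite set `Γ` of identities, over a countably infinite set
of variables, such that the identities of `K` are exactly the identities which hold in all
ai-semirings that satisfy `Γ`. -/
def IsFinitelyBased (K : (S : Type u) → [AiSemiring S] → Prop) : Prop :=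
  ∃ Γ : Set (AiTerm ℕ × AiTerm ℕ), Γ.Finite ∧ ∀ p q : AiTerm ℕ,
    ClassSatisfies K p q ↔
      ClassSatisfies (fun (S : Type u) [AiSemiring S] => ∀ g ∈ Γ, Satisfies S g.1 g.2) p q

/-! ### The flat semirings `S_c(W)` -/

/-- `S_c(W)`: the nonempty subwords of the words in `W`, and a new symbol `0`.
Words over the alphabet `A` in the free commutative semigroup are (nonempty) multisets, and
subwords are submultisets. -/
inductive Sc {A : Type u} (W : Set (Multiset A)) : Type u
  | zero : Sc W
  | word (m : Multiset A) (h0 : m ≠ 0) (hW : ∃ w ∈ W, m ≤ w) : Sc W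

namespace Sc

section

variable {A : Type u} {W : Set (Multiset A)}

open Classical in
/-- Flat addition: `x + x = x`, and `x + y = 0` for `x ≠ y`. -/
noncomputable instance : Add (Sc W) := ⟨fun x y => if x = y then x else zero⟩

open Classical in
/-- The product of two words if it is again a subword of a word in `W`, and `0` otherwise. -/
noncomputable instance : Mul (Sc W) :=
  ⟨fun x y =>
    match x, y with
    | word m h0 _, word n _ _ =>
      if h : ∃ w ∈ W, m + n ≤ w then
        word (m + n) (fun h1 => h0 (add_eq_zero.mp h1).1) h
      else zero
    | _, _ => zero⟩

open Classical in
theorem add_def (x y : Sc W) : x + y = if x = y then x else zero := rfl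

theorem zero_mul' (x : Sc W) : zero * x = zero := rfl

theorem mul_zero' (x : Sc W) : x * zero = zero := by
  cases x <;> rfl

theorem word_mul_word (m n : Multiset A) (hm0 : m ≠ 0) (hm : ∃ w ∈ W, m ≤ w) (hn0 : n ≠ 0)
    (hn : ∃ w ∈ W, n ≤ w) (h : ∃ w ∈ W, m + n ≤ w) :
    word m hm0 hm * word n hn0 hn = word (m + n) (fun h1 => hm0 (add_eq_zero.mp h1).1) h :=
  dif_pos h

theorem word_mul_word_neg (m n : Multiset A) (hm0 : m ≠ 0) (hm : ∃ w ∈ W, m ≤ w) (hn0 : n ≠ 0)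
    (hn : ∃ w ∈ W, n ≤ w) (h : ¬ ∃ w ∈ W, m + n ≤ w) :
    word m hm0 hm * word n hn0 hn = zero :=
  dif_neg h

theorem mul_comm' (x y : Sc W) : x * y = y * x := by
  rcases x with _ | ⟨m, hm0, hm⟩
  · exact (mul_zero' y).symm
  rcases y with _ | ⟨n, hn0, hn⟩
  · exact mul_zero' _
  by_cases h : ∃ w ∈ W, m + n ≤ w
  · rw [word_mul_word _ _ _ _ _ _ h, word_mul_word _ _ _ _ _ _ (by rwa [add_comm])]
    simp only [add_comm]
  · rw [word_mul_word_neg _ _ _ _ _ _ h, word_mul_word_neg _ _ _ _ _ _ (by rwa [add_comm])]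

theorem mul_assoc' (x y z : Sc W) : x * y * z = x * (y * z) := by
  rcases x with _ | ⟨m, hm0, hm⟩
  · rfl
  rcases y with _ | ⟨n, hn0, hn⟩
  · rfl
  rcases z with _ | ⟨k, hk0, hk⟩
  · rw [mul_zero', mul_zero', mul_zero']
  by_cases h : ∃ w ∈ W, m + n + k ≤ w
  · have h1 : ∃ w ∈ W, m + n ≤ w :=
      h.imp fun w hw => ⟨hw.1, (Multiset.le_add_right _ _).trans hw.2⟩
    have h' : ∃ w ∈ W, m + (n + k) ≤ w := by rwa [← add_assoc]
    have h2 : ∃ w ∈ W, n + k ≤ w :=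
      h'.imp fun w hw => ⟨hw.1, (Multiset.le_add_left _ _).trans hw.2⟩
    rw [word_mul_word m n _ _ _ _ h1, word_mul_word n k _ _ _ _ h2,
      word_mul_word _ _ _ _ _ _ h, word_mul_word _ _ _ _ _ _ h']
    simp only [add_assoc]
  · have h' : ¬ ∃ w ∈ W, m + (n + k) ≤ w := by rwa [← add_assoc]
    have e1 : word m hm0 hm * word n hn0 hn * word k hk0 hk = zero := by
      by_cases h1 : ∃ w ∈ W, m + n ≤ w
      · rw [word_mul_word _ _ _ _ _ _ h1, word_mul_word_neg _ _ _ _ _ _ h]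
      · rw [word_mul_word_neg _ _ _ _ _ _ h1, zero_mul']
    have e2 : word m hm0 hm * (word n hn0 hn * word k hk0 hk) = zero := by
      by_cases h2 : ∃ w ∈ W, n + k ≤ w
      · rw [word_mul_word _ _ _ _ _ _ h2, word_mul_word_neg _ _ _ _ _ _ h']
      · rw [word_mul_word_neg _ _ _ _ _ _ h2, mul_zero']
    rw [e1, e2]

/-- `0`-cancellativity. -/
theorem mul_left_cancel' (x y z : Sc W) (h : x * y = x * z) (h0 : x * y ≠ zero) : y = z := by
  rcases x with _ | ⟨m, hm0, hm⟩
  · exact absurd rfl h0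
  rcases y with _ | ⟨n, hn0, hn⟩
  · exact absurd (mul_zero' _) h0
  rcases z with _ | ⟨k, hk0, hk⟩
  · exact absurd (h.trans (mul_zero' _)) h0
  by_cases h1 : ∃ w ∈ W, m + n ≤ w
  · by_cases h2 : ∃ w ∈ W, m + k ≤ w
    · rw [word_mul_word _ _ _ _ _ _ h1, word_mul_word _ _ _ _ _ _ h2, word.injEq] at h
      have h3 := add_left_cancel h
      subst h3
      rfl
    · exact absurd (h.trans (word_mul_word_neg _ _ _ _ _ _ h2)) h0
  · exact absurd (word_mul_word_neg _ _ _ _ _ _ h1) h0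

theorem mul_add' (x y z : Sc W) : x * (y + z) = x * y + x * z := by
  rw [add_def, add_def]
  by_cases h : y = z
  · rw [if_pos h, if_pos (by rw [h])]
  · rw [if_neg h, mul_zero']
    split_ifs with h1
    · by_contra h0
      exact h (mul_left_cancel' x y z h1 fun h2 => h0 h2.symm)
    · rfl

noncomputable instance : AiSemiring (Sc W) where
  add_assoc x y z := by
    simp only [add_def]
    grind
  add_comm x y := by
    simp only [add_def]
    grind
  mul_assoc := mul_assoc'
  left_distrib := mul_add'
  right_distrib x y z := by rw [mul_comm', mul_add', mul_comm' z x, mul_comm' z y]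
  add_idem x := by rw [add_def, if_pos rfl]

end

end Sc

/-! ### Hypergraphs -/

/-- A `3`-uniform hypergraph with finitely many hyperedges on the vertex set `V`. -/
structure Hypergraph3 (V : Type u) where
  edges : Finset (Finset V)
  uniform : ∀ e ∈ edges, e.card = 3

namespace Hypergraph3

variable {V : Type u}

open Classical in
/-- `2`-colourability: both colours occur on each hyperedge. -/
def TwoColourable (H : Hypergraph3 V) : Prop :=
  ∃ φ : V → Fin 2, ∀ e ∈ H.edges, (e.image φ).card = 2

/-- There is a cycle `v₁, e₁, v₂, e₂, …, vₙ, eₙ` of length `n ≥ 2`: the vertices are distinct,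
the hyperedges are distinct, and `vᵢ, vᵢ₊₁ ∈ eᵢ` with indices modulo `n`. -/
def HasCycle (H : Hypergraph3 V) (n : ℕ) : Prop :=
  2 ≤ n ∧ ∃ (v : Fin n → V) (e : Fin n → Finset V),
    Function.Injective v ∧ Function.Injective e ∧
      ∀ i, e i ∈ H.edges ∧ v i ∈ e i ∧ v (finRotate n i) ∈ e i

/-- The girth: the length of a shortest cycle (`⊤` if there is no cycle). -/
noncomputable def girth (H : Hypergraph3 V) : ℕ∞ :=
  ⨅ (n : ℕ) (_ : H.HasCycle n), (n : ℕ∞)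

/-- `{x, y, z}` is a hyperedge. -/
def IsEdge (H : Hypergraph3 V) (x y z : V) : Prop :=
  ∃ e ∈ H.edges, (e : Set V) = {x, y, z}

theorem edges_nonempty {H : Hypergraph3 V} (h : ¬ H.TwoColourable) : H.edges.Nonempty := by
  by_contra h0
  rw [Finset.not_nonempty_iff_eq_empty] at h0
  exact h ⟨fun _ => 0, by simp [h0]⟩

open Classical in
/-- The list of all hyperedge products `x_{v₁} x_{v₂} x_{v₃}`, `{v₁, v₂, v₃}` a hyperedge; each
hyperedge contributes six of them. -/
noncomputable def hyperedgeProducts [Fintype V] (H : Hypergraph3 V) : List (AiTerm V) :=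
  ((Finset.univ.filter fun p : V × V × V => H.IsEdge p.1 p.2.1 p.2.2).toList).map
    fun p => ((AiTerm.var p.1).mul (AiTerm.var p.2.1)).mul (AiTerm.var p.2.2)

theorem hyperedgeProducts_ne_nil [Fintype V] {H : Hypergraph3 V} (h : H.edges.Nonempty) :
    H.hyperedgeProducts ≠ [] := by
  classical
  obtain ⟨e, he⟩ := h
  obtain ⟨x, y, z, -, -, -, rfl⟩ := Finset.card_eq_three.mp (H.uniform e he)
  intro h0
  have h1 : (x, y, z) ∈ Finset.univ.filter fun p : V × V × V => H.IsEdge p.1 p.2.1 p.2.2 := by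
    simp only [Finset.mem_filter, Finset.mem_univ, true_and]
    exact ⟨_, he, by simp⟩
  rw [hyperedgeProducts, List.map_eq_nil_iff, Finset.toList_eq_nil] at h0
  rw [h0] at h1
  simp at h1

/-- The term `t_H`: the sum of all hyperedge products. -/
noncomputable def term [Fintype V] (H : Hypergraph3 V) (h : H.edges.Nonempty) : AiTerm V :=
  AiTerm.sum H.hyperedgeProducts (hyperedgeProducts_ne_nil h)

/-- The defining relations of the multiplicative semigroup of the hypergraph semiring of `H`,
on the generators `some v` (for the element `a_v`, `v ∈ V`) and `none` (for `∞`). -/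
inductive Rel (H : Hypergraph3 V) :
    FreeSemigroup (Option V) → FreeSemigroup (Option V) → Prop
  | inf_mul (s : FreeSemigroup (Option V)) :
      Rel H (FreeSemigroup.of none * s) (FreeSemigroup.of none)
  | mul_inf (s : FreeSemigroup (Option V)) :
      Rel H (s * FreeSemigroup.of none) (FreeSemigroup.of none)
  | comm (x y : V) :
      Rel H (FreeSemigroup.of (some x) * FreeSemigroup.of (some y))
        (FreeSemigroup.of (some y) * FreeSemigroup.of (some x))
  | not_adj (x y : V) (h : ¬ (x ≠ y ∧ ∃ e ∈ H.edges, x ∈ e ∧ y ∈ e)) :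
      Rel H (FreeSemigroup.of (some x) * FreeSemigroup.of (some y)) (FreeSemigroup.of none)
  | edge (x₁ x₂ x₃ y₁ y₂ y₃ : V) (hx : H.IsEdge x₁ x₂ x₃) (hy : H.IsEdge y₁ y₂ y₃) :
      Rel H
        (FreeSemigroup.of (some x₁) * FreeSemigroup.of (some x₂) * FreeSemigroup.of (some x₃))
        (FreeSemigroup.of (some y₁) * FreeSemigroup.of (some y₂) * FreeSemigroup.of (some y₃))
  | link (x₁ x₂ y₁ y₂ z : V) (hx : H.IsEdge x₁ x₂ z) (hy : H.IsEdge y₁ y₂ z) :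
      Rel H (FreeSemigroup.of (some x₁) * FreeSemigroup.of (some x₂))
        (FreeSemigroup.of (some y₁) * FreeSemigroup.of (some y₂))

/-- The hypergraph semiring `S_H`: the semigroup generated by the `a_v` and `∞` subject to the
defining relations, with the flat addition with top `∞`. It is an ai-semiring when the girth of `H`
is at least `5`; the operations are defined in general. -/
def HypSemiring (H : Hypergraph3 V) : Type u := (conGen H.Rel).Quotient

namespace HypSemiring

variable {H : Hypergraph3 V}

instance : Semigroup H.HypSemiring := inferInstanceAs (Semigroup (conGen H.Rel).Quotient)

/-- The element `∞`. -/
def inf : H.HypSemiring := ((FreeSemigroup.of none : FreeSemigroup (Option V)) :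
  (conGen H.Rel).Quotient)

/-- The generator `a_v`. -/
def gen (x : V) : H.HypSemiring := ((FreeSemigroup.of (some x) : FreeSemigroup (Option V)) :
  (conGen H.Rel).Quotient)

open Classical in
/-- Flat addition: `x + x = x`, and `x + y = ∞` for `x ≠ y`. -/
noncomputable instance : Add H.HypSemiring := ⟨fun x y => if x = y then x else inf⟩

end HypSemiring

/-- A non-hyperedge term for `H`: under `x_v ↦ a_v` its value in the hypergraph semiring is not
the element `a`, the common value of all `a_{v₁} a_{v₂} a_{v₃}` with `{v₁, v₂, v₃}` a hyperedge. -/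
def IsNonHyperedgeTerm (H : Hypergraph3 V) (w : AiTerm V) : Prop :=
  ∀ x y z : V, H.IsEdge x y z →
    w.eval (HypSemiring.gen : V → H.HypSemiring) ≠ HypSemiring.gen x * HypSemiring.gen y * HypSemiring.gen z

end Hypergraph3

/-! The argument by contradiction: a finite basis uses a bounded number of variables, so for some `N
≥ 2` every identity in it has fewer than `N` of them. Since `H N` has no cycles of length at most
`N`, its hypergraph semiring cannot be told apart from `S_c(abc)` by identities this short, so it
satisfies the whole basis and hence every identity of the variety in finitely many variables. But
`x_v ↦ a_v` sends `t` to `a` and `w` to something else, which refutes `t ≈ t + w`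
(`Hypergraph3.not_satisfies_model`).

The core is `Hypergraph3.Model.satisfies_of_satisfies`. An assignment of fewer than `N` variables
names few vertices, and the hyperedges inside so small a set form a hyperforest
(`Hypergraph3.isForest_filter`). A rainbow colouring of this hyperforest by the letters `a, b, c`
turns the assignment into one in `S_c(abc)`. Hyperforests have enough rainbow colourings
(`IsForest.exists_rainbow_eq_iff`, `IsForest.exists_rainbow_not_injective`) for a word to have the
value `a` exactly when all these colourings send it to `abc` (`Hypergraph3.Model.lift_eq_top_iff`).
Identities of `S_c(abc)` therefore preserve the value `a`, and translations of `a` separate the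
remaining elements.

The semiring is handled through an explicit model with elements `inf`, `one v`, `two v`, `top`,
whose comparison with the presented semigroup is needed in one direction only. -/

/-! ### Rainbow colourings of hyperforests -/

section Forest

/-- Two vertices are linked if they lie in a common member of `F`. -/
def EdgeLinked {V : Type u} (F : Finset (Finset V)) (x y : V) : Prop :=
  ∃ e ∈ F, x ∈ e ∧ y ∈ e

/-- Two vertices are in the same component of `F`. -/
def EdgeJoined {V : Type u} (F : Finset (Finset V)) : V → V → Prop :=
  Relation.ReflTransGen (EdgeLinked F)

open Classical in
/-- `F` is a hyperforest: removing a member of `F` separates its vertices. -/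
def IsForest {V : Type u} (F : Finset (Finset V)) : Prop :=
  ∀ e ∈ F, ∀ x ∈ e, ∀ y ∈ e, x ≠ y → ¬ EdgeJoined (F.erase e) x y

/-- `φ` is injective on the members of `F`. -/
def Rainbow {V : Type u} (F : Finset (Finset V)) (φ : V → Fin 3) : Prop :=
  ∀ e ∈ F, Set.InjOn φ e

variable {V : Type u} {F F' : Finset (Finset V)}

theorem EdgeLinked.symm {x y : V} (h : EdgeLinked F x y) : EdgeLinked F y x :=
  h.imp fun _ he => ⟨he.1, he.2.2, he.2.1⟩

theorem EdgeLinked.mono {x y : V} (hF : F' ⊆ F) (h : EdgeLinked F' x y) : EdgeLinked F x y :=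
  h.imp fun _ he => ⟨hF he.1, he.2⟩

theorem EdgeJoined.symm {x y : V} (h : EdgeJoined F x y) : EdgeJoined F y x := by
  induction h with
  | refl => exact .refl
  | tail _ h ih => exact .head h.symm ih

theorem EdgeJoined.mono {x y : V} (hF : F' ⊆ F) (h : EdgeJoined F' x y) : EdgeJoined F x y :=
  Relation.ReflTransGen.mono (fun _ _ => EdgeLinked.mono hF) _ _ h

theorem EdgeJoined.iff_of_edgeLinked {x y z : V} (h : EdgeLinked F y z) : EdgeJoined F x y ↔ EdgeJoined F x z :=
  ⟨fun h1 => h1.tail h, fun h1 => h1.tail h.symm⟩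

theorem IsForest.mono (h : IsForest F) (hF : F' ⊆ F) : IsForest F' :=
  fun e he x hx y hy hxy h1 =>
    h e (hF he) x hx y hy hxy (h1.mono (by classical exact Finset.erase_subset_erase e hF))

/-- Permuting the colours separately on each component keeps every edge injectively coloured,
because an edge lies in one component. -/
theorem Rainbow.recolour {φ : V → Fin 3} (h : Rainbow F φ) (s : V → Equiv.Perm (Fin 3))
    (hs : ∀ x y, EdgeLinked F x y → s x = s y) : Rainbow F fun v => s v (φ v) := by
  intro e he x hx y hy hxy
  have h1 := hs x y ⟨e, he, hx, hy⟩
  simp only [h1] at hxy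
  exact h e he hx hy ((s y).injective hxy)

-- The gluing step of all inductions on the number of edges. Without the edge, its three vertices
-- lie in different components, so their colours can be permuted independently: by `i` on the
-- component of `x`, by `j` on that of `y`, and by `k` everywhere else.
open Classical in
theorem IsForest.exists_extension (hF : IsForest F) {x y z : V} (hxy : x ≠ y) (hxz : x ≠ z)
    (hyz : y ≠ z) (he : {x, y, z} ∈ F) {φ : V → Fin 3} (hφ : Rainbow (F.erase {x, y, z}) φ)
    (i j k : Equiv.Perm (Fin 3)) (hij : i (φ x) ≠ j (φ y)) (hik : i (φ x) ≠ k (φ z))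
    (hjk : j (φ y) ≠ k (φ z)) :
    ∃ ψ : V → Fin 3, Rainbow F ψ ∧ (∀ v, EdgeJoined (F.erase {x, y, z}) x v → ψ v = i (φ v)) ∧
      (∀ v, EdgeJoined (F.erase {x, y, z}) y v → ψ v = j (φ v)) := by
  set G := F.erase {x, y, z}
  have nxy : ¬ EdgeJoined G x y := hF _ he x (by simp) y (by simp) hxy
  have nxz : ¬ EdgeJoined G x z := hF _ he x (by simp) z (by simp) hxz
  have nyz : ¬ EdgeJoined G y z := hF _ he y (by simp) z (by simp) hyz
  let s : V → Equiv.Perm (Fin 3) := fun v =>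
    if EdgeJoined G x v then i else if EdgeJoined G y v then j else k
  have hs : ∀ v w, EdgeLinked G v w → s v = s w := by
    intro v w h
    simp only [s, EdgeJoined.iff_of_edgeLinked h]
  have h1 : ∀ v, EdgeJoined G x v → s v = i := fun v hv => if_pos hv
  have h2 : ∀ v, EdgeJoined G y v → s v = j := fun v hv => by
    have : ¬ EdgeJoined G x v := fun h => nxy (h.trans hv.symm)
    simp only [s, if_neg this, if_pos hv]
  have h3 : s z = k := by simp only [s, if_neg nxz, if_neg nyz]
  refine ⟨fun v => s v (φ v), ?_, fun v hv => by simp only [h1 v hv],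
    fun v hv => by simp only [h2 v hv]⟩
  intro e he'
  by_cases hee : e = {x, y, z}
  · subst hee
    have hx : s x = i := h1 x .refl
    have hy : s y = j := h2 y .refl
    intro a ha b hb hab
    simp only [Finset.coe_insert, Finset.coe_singleton, Set.mem_insert_iff,
      Set.mem_singleton_iff] at ha hb
    rcases ha with rfl | rfl | rfl <;> rcases hb with rfl | rfl | rfl <;>
      simp only [hx, hy, h3] at hab
    exacts [rfl, absurd hab hij, absurd hab hik, absurd hab.symm hij, rfl, absurd hab hjk,
      absurd hab.symm hik, absurd hab.symm hjk, rfl]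
  · exact hφ.recolour s hs e (Finset.mem_erase.mpr ⟨hee, he'⟩)

theorem Fin.exists_two_ne (i : Fin 3) : ∃ j k : Fin 3, i ≠ j ∧ i ≠ k ∧ j ≠ k := by
  revert i; decide

theorem IsForest.exists_rainbow (hF : IsForest F) (h3 : ∀ e ∈ F, e.card = 3) :
    ∃ φ : V → Fin 3, Rainbow F φ := by
  classical
  induction F using Finset.strongInduction with
  | H F ih =>
    rcases F.eq_empty_or_nonempty with rfl | ⟨e, he⟩
    · exact ⟨fun _ => 0, fun e he => absurd he (Finset.notMem_empty e)⟩
    obtain ⟨x, y, z, hxy, hxz, hyz, rfl⟩ := Finset.card_eq_three.mp (h3 e he)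
    obtain ⟨φ, hφ⟩ := ih _ (Finset.erase_ssubset he) (hF.mono (Finset.erase_subset _ _))
      fun e' he' => h3 e' (Finset.mem_of_mem_erase he')
    obtain ⟨j, k, hj, hk, hjk⟩ := Fin.exists_two_ne (φ x)
    obtain ⟨ψ, hψ, -⟩ := hF.exists_extension hxy hxz hyz he hφ 1 (Equiv.swap (φ y) j)
      (Equiv.swap (φ z) k) (by simpa using hj) (by simpa using hk) (by simpa using hjk)
    exact ⟨ψ, hψ⟩

theorem Fin.exists_eq_iff (i : Fin 3) (P : Prop) : ∃ j : Fin 3, i = j ↔ P := by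
  by_cases h : P
  · exact ⟨i, by simp [h]⟩
  · obtain ⟨j, k, hj, -⟩ := Fin.exists_two_ne i
    exact ⟨j, by simp [h, hj]⟩

theorem Fin.exists_ne_eq_iff {i j : Fin 3} (hij : i ≠ j) (P : Prop) :
    ∃ k l : Fin 3, k ≠ i ∧ k ≠ l ∧ i ≠ l ∧ (k = j ↔ P) := by
  have h1 : ∃ l : Fin 3, l ≠ i ∧ l ≠ j := by revert i j; decide
  obtain ⟨l, hli, hlj⟩ := h1
  by_cases h : P
  · exact ⟨j, l, hij.symm, hlj.symm, hli.symm, by simp [h]⟩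
  · exact ⟨l, j, hli, hlj, hij, by simp [h, hlj]⟩

/-- In a hyperforest, the colours of two distinct vertices under a rainbow colouring can be chosen
to be distinct, and to be equal if the vertices are not in a common edge. -/
theorem IsForest.exists_rainbow_eq_iff (hF : IsForest F) (h3 : ∀ e ∈ F, e.card = 3) {x v : V}
    (hxv : x ≠ v) (P : Prop) (hP : P → ¬ EdgeLinked F x v) :
    ∃ φ : V → Fin 3, Rainbow F φ ∧ (φ x = φ v ↔ P) := by
  classical
  induction F using Finset.strongInduction generalizing x P with
  | H F ih =>
    obtain ⟨φ₀, hφ₀⟩ := hF.exists_rainbow h3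
    by_cases hx : ∃ e ∈ F, x ∈ e
    swap
    · obtain ⟨j, hj⟩ := Fin.exists_eq_iff (φ₀ v) P
      -- A vertex on no edge is its own component, so its colour is free.
      refine ⟨_, hφ₀.recolour (fun w => if w = x then Equiv.swap (φ₀ x) j else 1) ?_, ?_⟩
      · rintro y z ⟨e, he, hy, hz⟩
        have h1 : y ≠ x := by rintro rfl; exact hx ⟨e, he, hy⟩
        have h2 : z ≠ x := by rintro rfl; exact hx ⟨e, he, hz⟩
        simp only [if_neg h1, if_neg h2]
      · simpa [hxv.symm, eq_comm] using hj
    obtain ⟨e, he, hxe⟩ := hx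
    have ih' := fun {x : V} => ih (x := x) _ (Finset.erase_ssubset he) (hF.mono (Finset.erase_subset _ _))
      fun e' he' => h3 e' (Finset.mem_of_mem_erase he')
    by_cases hv : ∃ y ∈ e, EdgeJoined (F.erase e) y v
    swap
    -- The component of `v` without `e` misses `e`, so it is a union of components of `F`, not
    -- containing `x`, and can be recoloured on its own.
    · obtain ⟨j, hj⟩ := Fin.exists_eq_iff (φ₀ x) P
      refine ⟨_, hφ₀.recolour
        (fun w => if EdgeJoined (F.erase e) v w then Equiv.swap (φ₀ v) j else 1) ?_, ?_⟩
      · rintro y z ⟨e', he', hy, hz⟩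
        by_cases hee : e' = e
        · subst hee
          have h1 : ¬ EdgeJoined (F.erase e') v y := fun h => hv ⟨y, hy, h.symm⟩
          have h2 : ¬ EdgeJoined (F.erase e') v z := fun h => hv ⟨z, hz, h.symm⟩
          simp only [if_neg h1, if_neg h2]
        · have h1 : EdgeLinked (F.erase e) y z := ⟨e', Finset.mem_erase.mpr ⟨hee, he'⟩, hy, hz⟩
          simp only [EdgeJoined.iff_of_edgeLinked h1]
      · have h1 : ¬ EdgeJoined (F.erase e) v x := fun h => hv ⟨x, hxe, h.symm⟩
        have h2 : EdgeJoined (F.erase e) v v := .refl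
        simpa [h1, h2] using hj
    obtain ⟨y, hye, hyv⟩ := hv
    obtain ⟨y', z', hxy', hxz', hyz', rfl⟩ :
        ∃ y' z', x ≠ y' ∧ x ≠ z' ∧ y' ≠ z' ∧ e = {x, y', z'} := by
      have h1 : (e.erase x).card = 2 := by rw [Finset.card_erase_of_mem hxe, h3 e he]
      obtain ⟨p, q, hpq, h2⟩ := Finset.card_eq_two.mp h1
      have hp : p ∈ e.erase x := by simp [h2]
      have hq : q ∈ e.erase x := by simp [h2]
      exact ⟨p, q, (Finset.ne_of_mem_erase hp).symm, (Finset.ne_of_mem_erase hq).symm, hpq,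
        by rw [← h2, Finset.insert_erase hxe]⟩
    by_cases hyx : y = x
    · subst hyx
      -- Here `v` hangs on `x` itself: the smaller forest already decides the two colours, and the
      -- identity permutation on this component preserves them.
      obtain ⟨φ, hφ, h1⟩ := ih' hxv P fun p h => hP p (h.mono (Finset.erase_subset _ _))
      obtain ⟨j, k, hj, hk, hjk⟩ := Fin.exists_two_ne (φ y)
      obtain ⟨ψ, hψ, h2, -⟩ := hF.exists_extension hxy' hxz' hyz' he hφ 1 (Equiv.swap (φ y') j)
        (Equiv.swap (φ z') k) (by simpa using hj) (by simpa using hk) (by simpa using hjk)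
      refine ⟨ψ, hψ, ?_⟩
      rw [h2 v hyv, h2 y .refl]
      exact h1
    · have hxy : x ≠ y := Ne.symm hyx
      obtain ⟨z, hxz, hyz, h4⟩ : ∃ z, x ≠ z ∧ y ≠ z ∧ ({x, y', z'} : Finset V) = {x, y, z} := by
        simp only [Finset.mem_insert, Finset.mem_singleton] at hye
        rcases hye with rfl | rfl | rfl
        · exact absurd rfl hyx
        · exact ⟨z', hxz', hyz', rfl⟩
        · exact ⟨y', hxy', hyz'.symm, by rw [Finset.pair_comm]⟩
      rw [h4] at he ih' hyv hxe hye
      by_cases hvy : y = v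
      · subst hvy
        refine ⟨φ₀, hφ₀, ?_⟩
        have h1 : ¬ P := fun p => hP p ⟨_, he, hxe, hye⟩
        simp only [h1, iff_false]
        exact fun h => hxv (hφ₀ _ he hxe hye h)
      -- Here `v` hangs on `y`, another vertex of the edge. Once `y` and `v` have different colours,
      -- `x` only has to avoid the colour of `y`, so it may take the colour of `v` or the third one.
      · obtain ⟨φ, hφ, h1⟩ := ih' hvy False fun h => h.elim
        obtain ⟨k, l, h5, h6, h7, h8⟩ := Fin.exists_ne_eq_iff (fun h => h1.mp h) P
        obtain ⟨ψ, hψ, h9, h10⟩ := hF.exists_extension hxy hxz hyz he hφ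
          (Equiv.swap (φ x) k) 1 (Equiv.swap (φ z) l) (by simpa using h5) (by simpa using h6)
          (by simpa using h7)
        refine ⟨ψ, hψ, ?_⟩
        rw [h9 x .refl, h10 v hyv]
        simpa using h8

/-- In a hyperforest, three vertices that do not form an edge can be coloured non-injectively. -/
theorem IsForest.exists_rainbow_not_injective (hF : IsForest F) (h3 : ∀ e ∈ F, e.card = 3)
    {x y z : V} (hxyz : ¬ ∃ e ∈ F, x ∈ e ∧ y ∈ e ∧ z ∈ e) :
    ∃ φ : V → Fin 3, Rainbow F φ ∧ (φ x = φ y ∨ φ x = φ z ∨ φ y = φ z) := by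
  classical
  obtain ⟨φ₀, hφ₀⟩ := hF.exists_rainbow h3
  by_cases hxy : x = y
  · exact ⟨φ₀, hφ₀, Or.inl (by rw [hxy])⟩
  by_cases hxz : x = z
  · exact ⟨φ₀, hφ₀, Or.inr (Or.inl (by rw [hxz]))⟩
  by_cases hyz : y = z
  · exact ⟨φ₀, hφ₀, Or.inr (Or.inr (by rw [hyz]))⟩
  by_cases h1 : EdgeLinked F x y
  swap
  · obtain ⟨φ, hφ, h⟩ := hF.exists_rainbow_eq_iff h3 hxy True fun _ => h1
    exact ⟨φ, hφ, Or.inl (h.mpr trivial)⟩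
  by_cases h2 : EdgeLinked F x z
  swap
  · obtain ⟨φ, hφ, h⟩ := hF.exists_rainbow_eq_iff h3 hxz True fun _ => h2
    exact ⟨φ, hφ, Or.inr (Or.inl (h.mpr trivial))⟩
  by_cases h4 : EdgeLinked F y z
  swap
  · obtain ⟨φ, hφ, h⟩ := hF.exists_rainbow_eq_iff h3 hyz True fun _ => h4
    exact ⟨φ, hφ, Or.inr (Or.inr (h.mpr trivial))⟩
  -- If all three pairs are linked, the path `x, z, y` avoids the edge through `x` and `y`,
  -- contradicting the forest property.
  obtain ⟨e₁, he₁, hx₁, hy₁⟩ := h1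
  obtain ⟨e₂, he₂, hx₂, hz₂⟩ := h2
  obtain ⟨e₃, he₃, hy₃, hz₃⟩ := h4
  have h12 : e₂ ≠ e₁ := by rintro rfl; exact hxyz ⟨_, he₁, hx₁, hy₁, hz₂⟩
  have h13 : e₃ ≠ e₁ := by rintro rfl; exact hxyz ⟨_, he₁, hx₁, hy₁, hz₃⟩
  have hxz' : EdgeLinked (F.erase e₁) x z := ⟨e₂, Finset.mem_erase.mpr ⟨h12, he₂⟩, hx₂, hz₂⟩
  have hzy' : EdgeLinked (F.erase e₁) z y := ⟨e₃, Finset.mem_erase.mpr ⟨h13, he₃⟩, hz₃, hy₃⟩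
  exact absurd ((Relation.ReflTransGen.single hxz').tail hzy') (hF e₁ he₁ x hx₁ y hy₁ hxy)

/-! ### Minimal chains and short cycles -/

/-- A chain of length `k` of members of `F` from `x` to `y`. -/
def IsEdgeChain (F : Finset (Finset V)) (x y : V) (k : ℕ) (v : ℕ → V) (e : ℕ → Finset V) : Prop :=
  v 0 = x ∧ v k = y ∧ ∀ i < k, e i ∈ F ∧ v i ∈ e i ∧ v (i + 1) ∈ e i

theorem EdgeJoined.exists_chain {x y : V} (h : EdgeJoined F x y) : ∃ k v e, IsEdgeChain F x y k v e := by
  induction h with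
  | refl => exact ⟨0, fun _ => x, fun _ => ∅, rfl, rfl, fun i hi => absurd hi (Nat.not_lt_zero i)⟩
  | @tail y z _ h ih =>
    obtain ⟨k, v, e, h0, hk, hi⟩ := ih
    obtain ⟨f, hf, hy, hz⟩ := h
    refine ⟨k + 1, fun i => if i ≤ k then v i else z, fun i => if i < k then e i else f,
      by simpa using h0, by simp, fun i hik => ?_⟩
    rcases Nat.lt_succ_iff_lt_or_eq.mp hik with h | rfl
    · simpa [h, h.le, Nat.succ_le_of_lt h] using hi i h
    · simpa [hf, hz, hk] using hy

/-- A shortest chain has no shortcuts; this later makes its vertices and its edges distinct. -/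
theorem EdgeJoined.exists_minimal_chain {x y : V} (h : EdgeJoined F x y) :
    ∃ k v e, IsEdgeChain F x y k v e ∧ (∀ i j, i < j → j < k → v i ∉ e j) ∧
      ∀ i < k, v i ≠ y := by
  classical
  have hex : ∃ k, ∃ v e, IsEdgeChain F x y k v e := h.exists_chain
  obtain ⟨v, e, hc⟩ := Nat.find_spec hex
  have hmin : ∀ m < Nat.find hex, ¬ ∃ v e, IsEdgeChain F x y m v e := fun m => Nat.find_min hex
  generalize Nat.find hex = k at hc hmin
  refine ⟨k, v, e, hc, fun i j hij hjk hmem => ?_, fun i hi hy => ?_⟩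
  · obtain ⟨h0, hk, hs⟩ := hc
    refine hmin (k - (j - i)) (by omega)
      -- If `v i ∈ e j`, pass from `v i` through `e j` straight to `v (j + 1)`, saving `j - i`
      -- edges.
      ⟨fun t => if t ≤ i then v t else v (t + (j - i)),
        fun t => if t < i then e t else e (t + (j - i)), by simpa using h0, ?_, fun t ht => ?_⟩
    · have h1 : ¬ k - (j - i) ≤ i := by omega
      have h2 : k - (j - i) + (j - i) = k := by omega
      simp only [if_neg h1, h2, hk]
    · rcases lt_trichotomy t i with h | rfl | h
      · simpa [h, h.le, Nat.succ_le_of_lt h] using hs t (by omega)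
      · have h2 : t + (j - t) = j := by omega
        have h3 : t + 1 + (j - t) = j + 1 := by omega
        have h4 := hs j hjk
        simpa [h2, h3, hmem] using ⟨h4.1, h4.2.2⟩
      · have h1 : ¬ t ≤ i := by omega
        have h2 : ¬ t < i := by omega
        have h3 : ¬ t + 1 ≤ i := by omega
        simp only [if_neg h1, if_neg h2, if_neg h3]
        have h4 := hs (t + (j - i)) (by omega)
        rwa [show t + (j - i) + 1 = t + 1 + (j - i) by omega] at h4
  · exact hmin i hi ⟨v, e, hc.1, hy, fun t ht => hc.2.2 t (ht.trans hi)⟩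

open Classical in
/-- The edges of a hypergraph inside a small set of vertices form a hyperforest if there are no
short cycles. -/
theorem Hypergraph3.isForest_filter (H : Hypergraph3 V) (U : Finset V)
    (hU : ∀ m ≤ U.card, ¬ H.HasCycle m) : IsForest (H.edges.filter (· ⊆ U)) := by
  intro f hf x hx y hy hxy hj
  obtain ⟨k, v, e, ⟨h0, hk, hs⟩, hve, hvy⟩ := hj.exists_minimal_chain
  have hk0 : k ≠ 0 := by rintro rfl; exact hxy (h0.symm.trans hk)
  have hvU : ∀ i ≤ k, v i ∈ U := by
    intro i hi
    rcases hi.lt_or_eq with h | rfl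
    · have h1 := hs i h
      exact (Finset.mem_filter.mp (Finset.mem_of_mem_erase h1.1)).2 h1.2.1
    · rw [hk]
      exact (Finset.mem_filter.mp hf).2 hy
  have hvne : ∀ i j, i < j → j ≤ k → v i ≠ v j := by
    intro i j hij hjk h
    rcases hjk.lt_or_eq with h1 | rfl
    · exact hve i j hij h1 (h ▸ (hs j h1).2.1)
    · exact hvy i hij (h.trans hk)
  have hvinj : Function.Injective fun i : Fin (k + 1) => v i := by
    intro i j hij
    rcases lt_trichotomy i j with h | h | h
    · exact absurd hij (hvne i j h (by omega))
    · exact h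
    · exact absurd hij.symm (hvne j i h (by omega))
  have hene : ∀ i j, i < j → j < k → e i ≠ e j := by
    intro i j hij hjk h
    exact hve i j hij hjk (h ▸ (hs i (hij.trans hjk)).2.1)
  have hef : ∀ i < k, e i ≠ f := fun i hi => Finset.ne_of_mem_erase (hs i hi).1
  -- The edge `f` closes the chain from `x` to `y` into a cycle of length `k + 1`. Its `k + 1`
  -- distinct vertices lie in `U`, which bounds the length.
  refine hU (k + 1) ?_ ⟨by omega, fun i => v i, fun i => if (i : ℕ) < k then e i else f, hvinj,
    ?_, ?_⟩
  · have h1 := Finset.card_le_card_of_injOn (s := (Finset.univ : Finset (Fin (k + 1)))) (t := U)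
      (fun i => v i) (fun i _ => hvU i (by omega)) hvinj.injOn
    simpa using h1
  · intro i j hij
    have hi := i.isLt
    have hj := j.isLt
    by_cases h1 : (i : ℕ) < k <;> by_cases h2 : (j : ℕ) < k
    · simp only [if_pos h1, if_pos h2] at hij
      rcases lt_trichotomy i j with h | h | h
      · exact absurd hij (hene i j h h2)
      · exact h
      · exact absurd hij.symm (hene j i h h1)
    · simp only [if_pos h1, if_neg h2] at hij
      exact absurd hij (hef _ h1)
    · simp only [if_neg h1, if_pos h2] at hij
      exact absurd hij.symm (hef _ h2)
    · exact Fin.ext (by omega)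
  · rintro ⟨i, hi⟩
    by_cases h1 : i < k
    · have h2 := hs i h1
      rw [finRotate_of_lt h1]
      simp only [if_pos h1]
      exact ⟨(Finset.mem_filter.mp (Finset.mem_of_mem_erase h2.1)).1, h2.2⟩
    · obtain rfl : i = k := by omega
      rw [finRotate_last']
      simp only [lt_irrefl, if_false]
      exact ⟨(Finset.mem_filter.mp hf).1, hk ▸ hy, h0 ▸ hx⟩

end Forest
/-! ### Terms and words in flat semirings -/

namespace AiTerm

/-- Renaming of variables. -/
def rename {X : Type u} {Y : Type v} (g : X → Y) : AiTerm X → AiTerm Y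
  | var x => var (g x)
  | add p q => add (rename g p) (rename g q)
  | mul p q => mul (rename g p) (rename g q)

open Classical in
/-- The set of variables of a term. -/
noncomputable def vars {X : Type u} : AiTerm X → Finset X
  | var x => {x}
  | add p q => vars p ∪ vars q
  | mul p q => vars p ∪ vars q

/-- The words whose sum is the given term. -/
def words {X : Type u} : AiTerm X → Set (FreeSemigroup X)
  | var x => {FreeSemigroup.of x}
  | add p q => words p ∪ words q
  | mul p q => Set.image2 (· * ·) (words p) (words q)

theorem words_nonempty {X : Type u} (p : AiTerm X) : p.words.Nonempty := by
  induction p with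
  | var x => exact ⟨_, rfl⟩
  | add p q hp _ => exact hp.mono Set.subset_union_left
  | mul p q hp hq => exact hp.image2 hq

theorem eval_rename {X : Type*} {Y : Type*} {S : Type*} [Add S] [Mul S] (g : X → Y) (f : Y → S)
    (p : AiTerm X) : (p.rename g).eval f = p.eval (f ∘ g) := by
  induction p with
  | var x => rfl
  | add p q hp hq => exact congrArg₂ _ hp hq
  | mul p q hp hq => exact congrArg₂ _ hp hq

theorem eval_congr {X : Type*} {S : Type*} [Add S] [Mul S] {f g : X → S} {p : AiTerm X}
    (h : ∀ x ∈ p.vars, f x = g x) : p.eval f = p.eval g := by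
  induction p with
  | var x => exact h x (by simp [vars])
  | add p q hp hq =>
    exact congrArg₂ (· + ·) (hp fun x hx => h x (by simp [vars, hx]))
      (hq fun x hx => h x (by simp [vars, hx]))
  | mul p q hp hq =>
    exact congrArg₂ (· * ·) (hp fun x hx => h x (by simp [vars, hx]))
      (hq fun x hx => h x (by simp [vars, hx]))

theorem eval_sum {X : Type*} {S : Type*} [AiSemiring S] {f : X → S} {s : S} :
    ∀ (l : List (AiTerm X)) (h : l ≠ []), (∀ p ∈ l, p.eval f = s) → (sum l h).eval f = s
  | [], h, _ => absurd rfl h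
  | [p], _, h => h p (by simp)
  | p :: q :: l, _, h => by
    have h1 := eval_sum (q :: l) (List.cons_ne_nil q l) fun r hr => h r (List.mem_cons_of_mem _ hr)
    have h2 := h p List.mem_cons_self
    simp only [sum, eval, h1, h2, AiSemiring.add_idem]

end AiTerm

/-- `z` is the top element of the flat semiring `S`. -/
structure IsFlatTop {S : Type*} [AiSemiring S] (z : S) : Prop where
  mul_left : ∀ x : S, z * x = z
  mul_right : ∀ x : S, x * z = z
  add_of_ne : ∀ x y : S, x ≠ y → x + y = z

namespace IsFlatTop

variable {S : Type*} [AiSemiring S] {z : S}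

theorem add_eq_iff (hz : IsFlatTop z) {x y s : S} (hs : s ≠ z) : x + y = s ↔ x = s ∧ y = s := by
  constructor
  · intro h
    by_cases hxy : x = y
    · subst hxy
      rw [AiSemiring.add_idem] at h
      exact ⟨h, h⟩
    · exact absurd (h.symm.trans (hz.add_of_ne x y hxy)) hs
  · rintro ⟨rfl, rfl⟩
    exact AiSemiring.add_idem _

/-- If `y ≠ y'`, then `x * (y + y')` is the top, while distributivity and idempotence make it `x *
y`. -/
theorem mul_left_cancel (hz : IsFlatTop z) {x y y' : S} (h : x * y = x * y') (h0 : x * y ≠ z) :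
    y = y' := by
  by_contra hne
  have h1 := mul_add x y y'
  rw [hz.add_of_ne _ _ hne, hz.mul_right, ← h, AiSemiring.add_idem] at h1
  exact h0 h1.symm

theorem mul_right_cancel (hz : IsFlatTop z) {x x' y : S} (h : x * y = x' * y) (h0 : x * y ≠ z) :
    x = x' := by
  by_contra hne
  have h1 := add_mul x x' y
  rw [hz.add_of_ne _ _ hne, hz.mul_left, ← h, AiSemiring.add_idem] at h1
  exact h0 h1.symm

/-- A term has a value other than the top element iff all its words have this value. -/
theorem eval_eq_iff (hz : IsFlatTop z) {X : Type*} (f : X → S) (p : AiTerm X) {s : S}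
    (hs : s ≠ z) : p.eval f = s ↔ ∀ w ∈ p.words, FreeSemigroup.lift f w = s := by
  induction p generalizing s with
  | var x => simp [AiTerm.eval, AiTerm.words]
  | add p q hp hq =>
    rw [AiTerm.eval, hz.add_eq_iff hs, hp hs, hq hs, AiTerm.words]
    constructor
    · rintro ⟨h1, h2⟩ w (hw | hw)
      exacts [h1 w hw, h2 w hw]
    · exact fun h => ⟨fun w hw => h w (Or.inl hw), fun w hw => h w (Or.inr hw)⟩
  | mul p q hp hq =>
    rw [AiTerm.eval, AiTerm.words]
    constructor
    · rintro h _ ⟨w, hw, w', hw', rfl⟩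
      have h1 : p.eval f ≠ z := fun h1 => hs (by rw [← h, h1, hz.mul_left])
      have h2 : q.eval f ≠ z := fun h2 => hs (by rw [← h, h2, hz.mul_right])
      simp only [map_mul]
      rw [(hp h1).mp rfl w hw, (hq h2).mp rfl w' hw', h]
    · intro h
      -- Fixing one word of each factor, cancellation forces all words of the other factor to share
      -- one value.
      obtain ⟨w, hw⟩ := p.words_nonempty
      obtain ⟨w', hw'⟩ := q.words_nonempty
      have h0 : ∀ v ∈ p.words, ∀ v' ∈ q.words,
          FreeSemigroup.lift f v * FreeSemigroup.lift f v' = s := fun v hv v' hv' => by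
        rw [← map_mul]
        exact h _ ⟨v, hv, v', hv', rfl⟩
      have h1 := h0 w hw w' hw'
      have hwz : FreeSemigroup.lift f w ≠ z := fun h2 => hs (by rw [← h1, h2, hz.mul_left])
      have hwz' : FreeSemigroup.lift f w' ≠ z := fun h2 => hs (by rw [← h1, h2, hz.mul_right])
      rw [(hp hwz).mpr fun v hv => hz.mul_right_cancel ((h0 v hv w' hw').trans h1.symm)
          (by rwa [h0 v hv w' hw']),
        (hq hwz').mpr fun v hv => hz.mul_left_cancel ((h0 w hw v hv).trans h1.symm)
          (by rwa [h0 w hw v hv]), h1]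

end IsFlatTop

/-! ### Words in `S_c(abc)` -/

namespace Sc

variable {A : Type u} {W : Set (Multiset A)}

theorem isFlatTop_zero : IsFlatTop (zero : Sc W) where
  mul_left := zero_mul'
  mul_right := mul_zero'
  add_of_ne x y h := by rw [add_def, if_neg h]

open Classical in
/-- The element of `S_c(W)` given by a multiset. -/
noncomputable def ofMultiset (W : Set (Multiset A)) (m : Multiset A) : Sc W :=
  if h : m ≠ 0 ∧ ∃ w ∈ W, m ≤ w then word m h.1 h.2 else zero

theorem ofMultiset_eq_word {m : Multiset A} (h0 : m ≠ 0) (h : ∃ w ∈ W, m ≤ w) :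
    ofMultiset W m = word m h0 h := dif_pos ⟨h0, h⟩

theorem ofMultiset_eq_zero {m : Multiset A} (h : ¬ ∃ w ∈ W, m ≤ w) :
    ofMultiset W m = zero := dif_neg fun h1 => h h1.2

theorem ofMultiset_zero : ofMultiset W 0 = zero := dif_neg fun h1 => h1.1 rfl

theorem ofMultiset_mul {m n : Multiset A} (hm : m ≠ 0) (hn : n ≠ 0) :
    ofMultiset W m * ofMultiset W n = ofMultiset W (m + n) := by
  have hmn : m + n ≠ 0 := fun h => hm (add_eq_zero.mp h).1
  by_cases h : ∃ w ∈ W, m + n ≤ w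
  · have h1 : ∃ w ∈ W, m ≤ w := h.imp fun w hw => ⟨hw.1, (Multiset.le_add_right _ _).trans hw.2⟩
    have h2 : ∃ w ∈ W, n ≤ w := h.imp fun w hw => ⟨hw.1, (Multiset.le_add_left _ _).trans hw.2⟩
    rw [ofMultiset_eq_word hm h1, ofMultiset_eq_word hn h2, ofMultiset_eq_word hmn h,
      word_mul_word _ _ _ _ _ _ h]
  · rw [ofMultiset_eq_zero h]
    by_cases h1 : ∃ w ∈ W, m ≤ w
    swap
    · rw [ofMultiset_eq_zero h1, zero_mul']
    by_cases h2 : ∃ w ∈ W, n ≤ w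
    swap
    · rw [ofMultiset_eq_zero h2, mul_zero']
    rw [ofMultiset_eq_word hm h1, ofMultiset_eq_word hn h2, word_mul_word_neg _ _ _ _ _ _ h]

theorem ofMultiset_eq_iff {m n : Multiset A} (hn0 : n ≠ 0) (hn : n ∈ W) :
    ofMultiset W m = ofMultiset W n ↔ m = n := by
  refine ⟨fun h => ?_, fun h => by rw [h]⟩
  rw [ofMultiset_eq_word hn0 ⟨n, hn, le_rfl⟩, ofMultiset] at h
  split_ifs at h with h1
  simpa using h

theorem ofMultiset_ne_zero {n : Multiset A} (hn0 : n ≠ 0) (hn : n ∈ W) :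
    ofMultiset W n ≠ zero := by
  rw [ofMultiset_eq_word hn0 ⟨n, hn, le_rfl⟩]
  exact fun h => by cases h

-- The nonemptiness condition is needed because the empty multiset stands for `zero`, although it
-- contributes nothing to the sum.
open Classical in
theorem lift_ofMultiset {X : Type*} (g : X → Multiset A) (x : X) (l : List X) :
    FreeSemigroup.lift (fun x => ofMultiset W (g x)) ⟨x, l⟩ =
      if ∀ y ∈ x :: l, g y ≠ 0 then ofMultiset W ((x :: l).map g).sum else zero := by
  induction l generalizing x with
  | nil =>
    have h1 : (⟨x, []⟩ : FreeSemigroup X) = FreeSemigroup.of x := rfl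
    rw [h1, FreeSemigroup.lift_of]
    by_cases h : g x = 0
    · simp [h, ofMultiset_zero]
    · simp [h]
  | cons y l ih =>
    have h1 : (⟨x, y :: l⟩ : FreeSemigroup X) = FreeSemigroup.of x * ⟨y, l⟩ := rfl
    rw [h1, map_mul, FreeSemigroup.lift_of, ih]
    by_cases hx : g x = 0
    · rw [hx, ofMultiset_zero, zero_mul', if_neg fun h => h x List.mem_cons_self hx]
    by_cases hl : ∀ z ∈ y :: l, g z ≠ 0
    · have h2 : ∀ z ∈ x :: y :: l, g z ≠ 0 := by
        rw [List.forall_mem_cons]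
        exact ⟨hx, hl⟩
      have h3 : ((y :: l).map g).sum ≠ 0 := by
        rw [List.map_cons, List.sum_cons]
        exact fun h => hl y List.mem_cons_self (add_eq_zero.mp h).1
      rw [if_pos hl, if_pos h2, ofMultiset_mul hx h3, List.map_cons (l := y :: l), List.sum_cons]
    · rw [if_neg hl, mul_zero', if_neg fun h => hl (List.forall_mem_cons.mp h).2]

theorem lift_ofMultiset_eq_iff {X : Type*} (g : X → Multiset A) (x : X) (l : List X)
    {n : Multiset A} (hn0 : n ≠ 0) (hn : n ∈ W) :
    FreeSemigroup.lift (fun x => ofMultiset W (g x)) ⟨x, l⟩ = ofMultiset W n ↔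
      (∀ y ∈ x :: l, g y ≠ 0) ∧ ((x :: l).map g).sum = n := by
  classical
  rw [lift_ofMultiset]
  split_ifs with h
  · rw [ofMultiset_eq_iff hn0 hn]
    exact (and_iff_right h).symm
  · exact ⟨fun h1 => absurd h1.symm (ofMultiset_ne_zero hn0 hn), fun h1 => absurd h1.1 h⟩

end Sc
/-! ### A flat model of the hypergraph semiring -/

namespace Hypergraph3

variable {V : Type u}

/-- Two vertices have at most one common hyperedge. -/
def IsLinear (H : Hypergraph3 V) : Prop :=
  ∀ x y z z' : V, H.IsEdge x y z → H.IsEdge x y z' → z = z'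

theorem IsEdge.swap {H : Hypergraph3 V} {x y z : V} (h : H.IsEdge x y z) : H.IsEdge y x z := by
  rwa [IsEdge, Set.insert_comm]

theorem IsEdge.rotate {H : Hypergraph3 V} {x y z : V} (h : H.IsEdge x y z) : H.IsEdge y z x := by
  rwa [IsEdge, Set.pair_comm z x, Set.insert_comm]

theorem IsEdge.exists_mem {H : Hypergraph3 V} {x y z : V} (h : H.IsEdge x y z) :
    ∃ e ∈ H.edges, (∀ w, w ∈ e ↔ w = x ∨ w = y ∨ w = z) ∧ x ≠ y ∧ x ≠ z ∧ y ≠ z := by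
  classical
  obtain ⟨e, he, h⟩ := h
  have h1 : e = {x, y, z} := by
    apply Finset.coe_injective
    simpa using h
  have h3 := H.uniform e he
  refine ⟨e, he, fun w => by simp [h1], ?_, ?_, ?_⟩
  · rintro rfl
    have := Finset.card_le_two (a := x) (b := z)
    simp_all
  · rintro rfl
    have := Finset.card_le_two (a := x) (b := y)
    rw [Finset.pair_comm, Finset.insert_comm] at h1
    simp_all [Finset.pair_comm]
  · rintro rfl
    have := Finset.card_le_two (a := x) (b := y)
    simp_all

theorem isEdge_of_mem {H : Hypergraph3 V} {e : Finset V} (he : e ∈ H.edges) {x y z : V}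
    (hx : x ∈ e) (hy : y ∈ e) (hz : z ∈ e) (hxy : x ≠ y) (hxz : x ≠ z) (hyz : y ≠ z) :
    H.IsEdge x y z := by
  classical
  refine ⟨e, he, ?_⟩
  have h1 : ({x, y, z} : Finset V) = e := by
    apply Finset.eq_of_subset_of_card_le
    · simp [Finset.insert_subset_iff, hx, hy, hz]
    · rw [H.uniform e he, Finset.card_eq_three.mpr ⟨x, y, z, hxy, hxz, hyz, rfl⟩]
  rw [← h1]
  simp

/-- Two different hyperedges sharing `x` and `y` would form a cycle of length two. -/
theorem isLinear_of_not_hasCycle {H : Hypergraph3 V} (h : ¬ H.HasCycle 2) : H.IsLinear := by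
  intro x y z z' hz hz'
  obtain ⟨e, he, hm, hxy, hxz, hyz⟩ := hz.exists_mem
  obtain ⟨e', he', hm', -, hxz', hyz'⟩ := hz'.exists_mem
  by_cases hee : e = e'
  · subst hee
    have h1 := (hm' z).mp ((hm z).mpr (by simp))
    rcases h1 with h1 | h1 | h1
    exacts [absurd h1.symm hxz, absurd h1.symm hyz, h1]
  · refine absurd ⟨le_rfl, ![x, y], ![e, e'], ?_, ?_, ?_⟩ h
    · intro i j hij
      fin_cases i <;> fin_cases j <;> simp_all
    · intro i j hij
      fin_cases i <;> fin_cases j <;> simp_all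
    · intro i
      fin_cases i
      · simp [he, hm]
      · simp [he', hm']

/-- The elements of the hypergraph semiring: `∞`, the generators `a_v`, the products of two
generators that are adjacent to `v` in a common hyperedge, and the product of a hyperedge. -/
inductive Model (H : Hypergraph3 V) : Type u
  | inf : Model H
  | one (v : V) : Model H
  | two (v : V) : Model H
  | top : Model H

namespace Model

variable {H : Hypergraph3 V}

open Classical in
/-- Flat addition. -/
noncomputable instance : Add H.Model := ⟨fun x y => if x = y then x else inf⟩

open Classical in
/-- The product of the hypergraph semiring. -/
noncomputable instance : Mul H.Model :=
  ⟨fun x y =>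
    match x, y with
    | one x, one y => if h : ∃ z, H.IsEdge x y z then two h.choose else inf
    | one x, two y => if x = y then top else inf
    | two x, one y => if x = y then top else inf
    | _, _ => inf⟩

open Classical in
theorem add_def (x y : H.Model) : x + y = if x = y then x else inf := rfl

open Classical in
theorem one_mul_two (x y : V) : (one x * two y : H.Model) = if x = y then top else inf := rfl

open Classical in
theorem two_mul_one (x y : V) : (two x * one y : H.Model) = if x = y then top else inf := rfl

theorem one_mul_one_of_not {x y : V} (h : ¬ ∃ z, H.IsEdge x y z) :
    (one x * one y : H.Model) = inf := dif_neg h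

theorem inf_mul (x : H.Model) : inf * x = inf := by cases x <;> rfl

theorem mul_inf (x : H.Model) : x * inf = inf := by cases x <;> rfl

theorem top_mul (x : H.Model) : top * x = inf := by cases x <;> rfl

theorem mul_top (x : H.Model) : x * top = inf := by cases x <;> rfl

theorem one_mul_two_mul (x y : V) (z : H.Model) : one x * two y * z = inf := by
  rw [one_mul_two]
  split_ifs
  exacts [top_mul z, inf_mul z]

/-! ### Degrees and colour codes of elements -/

/-- The degree of an element: the number of generators in the product. -/
def deg : H.Model → ℕ
  | inf => 0
  | one _ => 1
  | two _ => 2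
  | top => 3

theorem deg_two (v : V) : (two v : H.Model).deg = 2 := rfl

theorem deg_top : (top : H.Model).deg = 3 := rfl

theorem deg_eq_zero {x : H.Model} : x.deg = 0 ↔ x = inf := by
  cases x <;> simp [deg]

/-- The letters of an element under a colouring of the vertices. -/
def code (φ : V → Fin 3) : H.Model → Multiset (Fin 3)
  | inf => 0
  | one v => {φ v}
  | two v => (Finset.univ : Finset (Fin 3)).val.erase (φ v)
  | top => (Finset.univ : Finset (Fin 3)).val

theorem card_code (φ : V → Fin 3) (x : H.Model) : (x.code φ).card = x.deg := by
  rcases x with _ | x | x | _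
  · rfl
  · rfl
  · exact Multiset.card_erase_of_mem (Finset.mem_univ_val (φ x))
  · rfl

open Classical in
/-- The vertices occurring in the name of an element. -/
noncomputable def supp : H.Model → Finset V
  | inf => ∅
  | one v => {v}
  | two v => {v}
  | top => ∅

theorem card_supp_le (x : H.Model) : x.supp.card ≤ 1 := by
  cases x <;> simp [supp]

variable [hH : Fact H.IsLinear]

theorem one_mul_one {x y z : V} (h : H.IsEdge x y z) : (one x * one y : H.Model) = two z := by
  have h1 : ∃ z, H.IsEdge x y z := ⟨z, h⟩
  rw [show z = h1.choose from hH.out x y _ _ h h1.choose_spec]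
  exact dif_pos h1

theorem one_mul_one_eq_two {x y z : V} (h : (one x * one y : H.Model) = two z) :
    H.IsEdge x y z := by
  by_cases h1 : ∃ z, H.IsEdge x y z
  · obtain ⟨z', h1⟩ := h1
    rw [one_mul_one h1, two.injEq] at h
    rwa [← h]
  · rw [one_mul_one_of_not h1] at h
    cases h

open Classical in
theorem one_mul_one_mul_one (x y z : V) :
    (one x * one y * one z : H.Model) = if H.IsEdge x y z then top else inf := by
  by_cases h1 : ∃ w, H.IsEdge x y w
  · obtain ⟨w, h1⟩ := h1
    rw [one_mul_one h1, two_mul_one]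
    by_cases h2 : w = z
    · subst h2
      rw [if_pos rfl, if_pos h1]
    · rw [if_neg h2, if_neg fun h3 => h2 (hH.out _ _ _ _ h1 h3)]
  · rw [one_mul_one_of_not h1, inf_mul, if_neg fun h => h1 ⟨z, h⟩]

open Classical in
protected theorem mul_comm (x y : H.Model) : x * y = y * x := by
  rcases x with _ | x | x | _ <;> rcases y with _ | y | y | _ <;> try rfl
  · by_cases h : ∃ z, H.IsEdge x y z
    · obtain ⟨z, h⟩ := h
      rw [one_mul_one h, one_mul_one h.swap]
    · rw [one_mul_one_of_not h, one_mul_one_of_not fun h1 => h (h1.imp fun _ => IsEdge.swap)]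
  · rw [one_mul_two, two_mul_one, if_congr eq_comm rfl rfl]
  · rw [one_mul_two, two_mul_one, if_congr eq_comm rfl rfl]

theorem one_mul_one_mul_two (x y z : V) : (one x * one y * two z : H.Model) = inf := by
  by_cases h : ∃ w, H.IsEdge x y w
  · obtain ⟨w, h⟩ := h
    rw [one_mul_one h]
    rfl
  · rw [one_mul_one_of_not h, inf_mul]

protected theorem mul_assoc (x y z : H.Model) : x * y * z = x * (y * z) := by
  rcases x with _ | x | x | _
  · simp only [inf_mul]
  · rcases y with _ | y | y | _
    · simp only [inf_mul, mul_inf]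
    · rcases z with _ | z | z | _
      · simp only [mul_inf]
      · rw [Model.mul_comm (one x) (one y * one z), one_mul_one_mul_one, one_mul_one_mul_one]
        congr 1
        exact propext ⟨fun h => h.rotate, fun h => h.rotate.rotate⟩
      · rw [one_mul_one_mul_two, Model.mul_comm (one x), one_mul_two_mul]
      · simp only [mul_top, mul_inf]
    · rw [one_mul_two_mul, Model.mul_comm (one x)]
      rcases z with _ | z | z | _
      · rfl
      · rw [Model.mul_comm (two y), one_mul_two_mul]
      · rfl
      · rfl
    · simp only [mul_top, inf_mul, top_mul, mul_inf]
  · rcases y with _ | y | y | _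
    · simp only [inf_mul, mul_inf]
    · rw [Model.mul_comm (two x), one_mul_two_mul, Model.mul_comm (two x)]
      rcases z with _ | z | z | _
      · simp only [mul_inf, inf_mul]
      · rw [one_mul_one_mul_two]
      · rw [one_mul_two_mul]
      · simp only [mul_top, inf_mul]
    · rw [show (two x * two y : H.Model) = inf from rfl, inf_mul, Model.mul_comm (two x)]
      rcases z with _ | z | z | _
      · rfl
      · rw [Model.mul_comm (two y), one_mul_two_mul]
      · rfl
      · rfl
    · simp only [mul_top, inf_mul, top_mul, mul_inf]
  · simp only [top_mul, inf_mul]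

/-- Cancellation away from `inf` is what makes multiplication distribute over flat addition. For two
generators it rests on linearity: two vertices determine the third one of their hyperedge. -/
theorem mul_left_cancel_of_ne {x y z : H.Model} (h : x * y = x * z) (h0 : x * y ≠ inf) :
    y = z := by
  rcases x with _ | x | x | _
  · exact absurd (inf_mul y) h0
  · rcases y with _ | y | y | _
    · exact absurd rfl h0
    · obtain ⟨w, hw⟩ : ∃ w, H.IsEdge x y w := by
        by_contra h1
        exact h0 (one_mul_one_of_not h1)
      rw [one_mul_one hw] at h
      rcases z with _ | z | z | _
      · cases h
      · have h1 := one_mul_one_eq_two h.symm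
        rw [hH.out w x y z hw.rotate.rotate h1.rotate.rotate]
      · rw [one_mul_two] at h
        split_ifs at h
      · cases h
    · rw [one_mul_two] at h h0
      split_ifs at h h0 with h1
      swap
      · exact absurd rfl h0
      rcases z with _ | z | z | _
      · cases h
      · by_cases h2 : ∃ w, H.IsEdge x z w
        · obtain ⟨w, h2⟩ := h2
          rw [one_mul_one h2] at h
          cases h
        · rw [one_mul_one_of_not h2] at h
          cases h
      · rw [one_mul_two] at h
        split_ifs at h with h2
        rw [← h1, ← h2]
      · cases h
    · exact absurd rfl h0
  · rcases y with _ | y | y | _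
    · exact absurd rfl h0
    · rw [two_mul_one] at h h0
      split_ifs at h h0 with h1
      swap
      · exact absurd rfl h0
      rcases z with _ | z | z | _
      · cases h
      · rw [two_mul_one] at h
        split_ifs at h with h2
        rw [← h1, ← h2]
      · cases h
      · cases h
    · exact absurd rfl h0
    · exact absurd rfl h0
  · exact absurd (top_mul y) h0

protected theorem mul_add (x y z : H.Model) : x * (y + z) = x * y + x * z := by
  rw [add_def, add_def]
  by_cases h : y = z
  · rw [if_pos h, if_pos (by rw [h])]
  · rw [if_neg h, mul_inf]
    split_ifs with h1
    · by_contra h0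
      exact h (mul_left_cancel_of_ne h1 fun h2 => h0 h2.symm)
    · rfl

noncomputable instance : AiSemiring H.Model where
  add_assoc x y z := by
    simp only [add_def]
    grind
  add_comm x y := by
    simp only [add_def]
    grind
  mul_assoc := Model.mul_assoc
  left_distrib := Model.mul_add
  right_distrib x y z := by
    rw [Model.mul_comm, Model.mul_add, Model.mul_comm z x, Model.mul_comm z y]
  add_idem x := by rw [add_def, if_pos rfl]

theorem isFlatTop_inf : IsFlatTop (inf : H.Model) where
  mul_left := inf_mul
  mul_right := mul_inf
  add_of_ne x y h := by rw [add_def, if_neg h]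

theorem mul_eq_two {x y : H.Model} {z : V} (h : x * y = two z) :
    ∃ u v, x = one u ∧ y = one v ∧ H.IsEdge u v z := by
  rcases x with _ | x | x | _ <;> rcases y with _ | y | y | _ <;> try cases h
  · exact ⟨x, y, rfl, rfl, one_mul_one_eq_two h⟩
  · rw [one_mul_two] at h
    split_ifs at h
  · rw [two_mul_one] at h
    split_ifs at h

theorem mul_eq_top {x y : H.Model} (h : x * y = top) :
    ∃ v, (x = one v ∧ y = two v) ∨ (x = two v ∧ y = one v) := by
  rcases x with _ | x | x | _ <;> rcases y with _ | y | y | _ <;> try cases h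
  · by_cases h1 : ∃ z, H.IsEdge x y z
    · obtain ⟨z, h1⟩ := h1
      rw [one_mul_one h1] at h
      cases h
    · rw [one_mul_one_of_not h1] at h
      cases h
  · rw [one_mul_two] at h
    split_ifs at h with h1
    exact ⟨x, Or.inl ⟨rfl, by rw [h1]⟩⟩
  · rw [two_mul_one] at h
    split_ifs at h with h1
    exact ⟨x, Or.inr ⟨rfl, by rw [h1]⟩⟩

theorem mul_ne_one (x y : H.Model) (z : V) : x * y ≠ one z := by
  intro h
  rcases x with _ | x | x | _ <;> rcases y with _ | y | y | _ <;> try cases h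
  · by_cases h1 : ∃ z, H.IsEdge x y z
    · obtain ⟨z, h1⟩ := h1
      rw [one_mul_one h1] at h
      cases h
    · rw [one_mul_one_of_not h1] at h
      cases h
  · rw [one_mul_two] at h
    split_ifs at h
  · rw [two_mul_one] at h
    split_ifs at h

theorem deg_mul {x y : H.Model} (h : x * y ≠ inf) : (x * y).deg = x.deg + y.deg := by
  generalize hz : x * y = z at h ⊢
  rcases z with _ | z | z | _
  · exact absurd rfl h
  · exact absurd hz (mul_ne_one x y z)
  · obtain ⟨u, v, rfl, rfl, -⟩ := mul_eq_two hz
    rfl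
  · obtain ⟨v, ⟨rfl, rfl⟩ | ⟨rfl, rfl⟩⟩ := mul_eq_top hz <;> rfl

theorem deg_lift {X : Type*} (f : X → H.Model) (x : X) (l : List X)
    (h : FreeSemigroup.lift f ⟨x, l⟩ ≠ inf) :
    (∀ y ∈ x :: l, (f y).deg ≠ 0) ∧
      ((x :: l).map fun y => (f y).deg).sum = (FreeSemigroup.lift f ⟨x, l⟩).deg := by
  induction l generalizing x with
  | nil =>
    have h1 : (⟨x, []⟩ : FreeSemigroup X) = FreeSemigroup.of x := rfl
    rw [h1, FreeSemigroup.lift_of] at h ⊢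
    simpa [deg_eq_zero] using h
  | cons y l ih =>
    have h1 : (⟨x, y :: l⟩ : FreeSemigroup X) = FreeSemigroup.of x * ⟨y, l⟩ := rfl
    rw [h1, map_mul, FreeSemigroup.lift_of] at h ⊢
    have h2 : FreeSemigroup.lift f ⟨y, l⟩ ≠ inf := fun h2 => h (by rw [h2, mul_inf])
    have h3 : f x ≠ inf := fun h3 => h (by rw [h3, inf_mul])
    obtain ⟨h4, h5⟩ := ih y h2
    rw [List.forall_mem_cons, deg_mul h, List.map_cons, List.sum_cons, h5, Ne, deg_eq_zero]
    exact ⟨⟨h3, h4⟩, rfl⟩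

theorem singleton_add_erase_eq_univ_iff {i j : Fin 3} :
    {i} + (Finset.univ : Finset (Fin 3)).val.erase j = (Finset.univ : Finset (Fin 3)).val ↔
      i = j := by
  revert i j; decide

theorem erase_add_singleton_eq_univ_iff {i j : Fin 3} :
    (Finset.univ : Finset (Fin 3)).val.erase i + {j} = (Finset.univ : Finset (Fin 3)).val ↔
      i = j := by
  revert i j; decide

theorem three_singletons_eq_univ_iff {i j k : Fin 3} :
    {i} + ({j} + {k}) = (Finset.univ : Finset (Fin 3)).val ↔ i ≠ j ∧ i ≠ k ∧ j ≠ k := by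
  revert i j k; decide

/-! ### Detecting the hyperedge product by colourings -/

/-- Words with the value `a` in the model are detected by colourings. -/
theorem lift_eq_top_iff {F : Finset (Finset V)} {U : Finset V} (hF : IsForest F)
    (hFU : ∀ e, e ∈ F ↔ e ∈ H.edges ∧ e ⊆ U) {X : Type*} (f : X → H.Model)
    (hf : ∀ x, (f x).supp ⊆ U) (x : X) (l : List X) :
    FreeSemigroup.lift f ⟨x, l⟩ = top ↔ ∀ φ, Rainbow F φ →
      (∀ y ∈ x :: l, (f y).code φ ≠ 0) ∧
        ((x :: l).map fun y => (f y).code φ).sum = (Finset.univ : Finset (Fin 3)).val := by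
  have h3 : ∀ e ∈ F, e.card = 3 := fun e he => H.uniform e ((hFU e).mp he).1
  obtain ⟨φ₀, hφ₀⟩ := hF.exists_rainbow h3
  -- Both sides force nonzero degrees with total 3: the left by additivity of degree, the right by
  -- counting letters. Only the shapes 3, 1+2, 2+1 and 1+1+1 remain.
  by_cases hdeg : (∀ y ∈ x :: l, (f y).deg ≠ 0) ∧ ((x :: l).map fun y => (f y).deg).sum = 3
  swap
  · refine iff_of_false (fun h => hdeg ?_) fun h => hdeg ?_
    · have h1 := deg_lift f x l (by rw [h]; exact fun h => by cases h)
      rwa [h] at h1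
    · obtain ⟨h1, h2⟩ := h φ₀ hφ₀
      have h4 := congrArg (Multiset.cardHom (α := Fin 3)) h2
      rw [map_list_sum, List.map_map] at h4
      refine ⟨fun y hy => ?_, ?_⟩
      · rw [← card_code φ₀, Ne, Multiset.card_eq_zero]
        exact h1 y hy
      · simpa [Function.comp_def, card_code] using h4
  have hne : ∀ φ, ∀ y ∈ x :: l, (f y).code φ ≠ 0 := fun φ y hy => by
    rw [Ne, ← Multiset.card_eq_zero, card_code]
    exact hdeg.1 y hy
  have key : (FreeSemigroup.lift f ⟨x, l⟩ = top ↔ ∀ φ, Rainbow F φ →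
      ((x :: l).map fun y => (f y).code φ).sum = (Finset.univ : Finset (Fin 3)).val) := by
    obtain ⟨hd, hs⟩ := hdeg
    have hx := hd x (by simp)
    have hxU := hf x
    match l with
    | [] =>
      have h1 : (⟨x, []⟩ : FreeSemigroup X) = FreeSemigroup.of x := rfl
      simp only [h1, FreeSemigroup.lift_of, List.map_cons, List.map_nil, List.sum_cons,
        List.sum_nil, add_zero] at hs ⊢
      generalize f x = p at *
      rcases p with _ | p | p | _ <;> simp [deg] at hs
      simp [code]
    | [y] =>
      have h1 : (⟨x, [y]⟩ : FreeSemigroup X) = FreeSemigroup.of x * FreeSemigroup.of y := rfl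
      have hy := hd y (by simp)
      simp only [h1, map_mul, FreeSemigroup.lift_of, List.map_cons, List.map_nil, List.sum_cons,
        List.sum_nil, add_zero] at hs ⊢
      generalize f x = p at *
      generalize f y = q at *
      rcases p with _ | p | p | _ <;> rcases q with _ | q | q | _ <;> simp [deg] at hs hx hy
      · simp only [code, singleton_add_erase_eq_univ_iff, one_mul_two]
        by_cases h : p = q
        · simp [h]
        · simp only [h, if_false, reduceCtorEq, false_iff]
          -- Distinct vertices are separated by some rainbow colouring.
          obtain ⟨φ, h4, h5⟩ := hF.exists_rainbow_eq_iff h3 h False fun h => h.elim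
          exact fun h6 => h5.mp (h6 φ h4)
      · simp only [code, erase_add_singleton_eq_univ_iff, two_mul_one]
        by_cases h : p = q
        · simp [h]
        · simp only [h, if_false, reduceCtorEq, false_iff]
          obtain ⟨φ, h4, h5⟩ := hF.exists_rainbow_eq_iff h3 h False fun h => h.elim
          exact fun h6 => h5.mp (h6 φ h4)
    | [y, z] =>
      have h1 : (⟨x, [y, z]⟩ : FreeSemigroup X) =
        FreeSemigroup.of x * FreeSemigroup.of y * FreeSemigroup.of z := rfl
      have hy := hd y (by simp)
      have hz := hd z (by simp)
      have hyU := hf y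
      have hzU := hf z
      simp only [h1, map_mul, FreeSemigroup.lift_of, List.map_cons, List.map_nil, List.sum_cons,
        List.sum_nil, add_zero] at hs ⊢
      generalize f x = p at *
      generalize f y = q at *
      generalize f z = r at *
      obtain ⟨p, rfl⟩ : ∃ v, p = one v := by
        rcases p with _ | p | p | _
        · exact absurd rfl hx
        · exact ⟨p, rfl⟩
        · rw [deg_two] at hs; omega
        · rw [deg_top] at hs; omega
      obtain ⟨q, rfl⟩ : ∃ v, q = one v := by
        rcases q with _ | q | q | _
        · exact absurd rfl hy
        · exact ⟨q, rfl⟩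
        · rw [deg_two] at hs; omega
        · rw [deg_top] at hs; omega
      obtain ⟨r, rfl⟩ : ∃ v, r = one v := by
        rcases r with _ | r | r | _
        · exact absurd rfl hz
        · exact ⟨r, rfl⟩
        · rw [deg_two] at hs; omega
        · rw [deg_top] at hs; omega
      simp only [supp, Finset.singleton_subset_iff] at hxU hyU hzU
      simp only [one_mul_one_mul_one, code, three_singletons_eq_univ_iff]
      by_cases h : H.IsEdge p q r
      · simp only [if_pos h, true_iff]
        intro φ hφ
        obtain ⟨e, he, hm, hpq, hpr, hqr⟩ := h.exists_mem
        have heF : e ∈ F := (hFU e).mpr ⟨he, fun w hw => by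
          rcases (hm w).mp hw with rfl | rfl | rfl <;> assumption⟩
        have hinj := hφ e heF
        have hp : p ∈ (e : Set V) := (hm p).mpr (by simp)
        have hq : q ∈ (e : Set V) := (hm q).mpr (by simp)
        have hr : r ∈ (e : Set V) := (hm r).mpr (by simp)
        exact ⟨hinj.ne hp hq hpq, hinj.ne hp hr hpr, hinj.ne hq hr hqr⟩
      · simp only [if_neg h, reduceCtorEq, false_iff]
        intro hall
        -- One colouring shows that the vertices are distinct, so an edge containing all three would
        -- be exactly `{p, q, r}`.
        obtain ⟨h4, h5, h6⟩ := hall φ₀ hφ₀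
        have hn : ¬ ∃ e ∈ F, p ∈ e ∧ q ∈ e ∧ r ∈ e := by
          rintro ⟨e, he, hp, hq, hr⟩
          exact h (isEdge_of_mem ((hFU e).mp he).1 hp hq hr (fun h => h4 (by rw [h]))
            (fun h => h5 (by rw [h])) fun h => h6 (by rw [h]))
        obtain ⟨φ, hφ, h7⟩ := hF.exists_rainbow_not_injective h3 hn
        have h8 := hall φ hφ
        tauto
    | y :: z :: t :: l =>
      exfalso
      have hy := hd y (by simp)
      have hz := hd z (by simp)
      have ht := hd t (by simp)
      simp only [List.map_cons, List.sum_cons] at hs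
      omega
  rw [key]
  exact forall₂_congr fun φ _ => (and_iff_right (hne φ)).symm

end Model

end Hypergraph3
/-! ### Identities of the model -/

theorem AiTerm.vars_rename {X : Type u} {Y : Type v} [DecidableEq Y] (g : X → Y) (p : AiTerm X) :
    (p.rename g).vars = p.vars.image g := by
  induction p with
  | var x => simp [rename, vars]
  | add p q hp hq => simp only [rename, vars, hp, hq]; ext; simp; grind
  | mul p q hp hq => simp only [rename, vars, hp, hq]; ext; simp; grind

namespace Hypergraph3

namespace Model

variable {V : Type u} {H : Hypergraph3 V}

theorem lift_ofMultiset_code_eq_iff {A : Type v} {W : Set (Multiset A)} {c : Fin 3 → A}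
    (hc : Function.Injective c) (hW : (Finset.univ : Finset (Fin 3)).val.map c ∈ W)
    {X : Type*} (f : X → H.Model) (φ : V → Fin 3) (x : X) (l : List X) :
    FreeSemigroup.lift (fun x => Sc.ofMultiset W (((f x).code φ).map c)) ⟨x, l⟩ =
        Sc.ofMultiset W ((Finset.univ : Finset (Fin 3)).val.map c) ↔
      (∀ y ∈ x :: l, (f y).code φ ≠ 0) ∧
        ((x :: l).map fun y => (f y).code φ).sum = (Finset.univ : Finset (Fin 3)).val := by
  have h0 : (Finset.univ : Finset (Fin 3)).val.map c ≠ 0 := by simp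
  rw [Sc.lift_ofMultiset_eq_iff _ x l h0 hW]
  have h1 : ((x :: l).map fun y => ((f y).code φ).map c).sum =
      (((x :: l).map fun y => (f y).code φ).sum).map c := by
    rw [← Multiset.coe_mapAddMonoidHom, map_list_sum, List.map_map]
    rfl
  rw [h1, (Multiset.map_injective hc).eq_iff]
  simp only [Ne, Multiset.map_eq_zero]

variable [Fact H.IsLinear]

/-- An identity of `S_c(abc)` in few variables preserves the value `a` in the model. -/
theorem eval_eq_top_of_satisfies {A : Type v} {W : Set (Multiset A)} {c : Fin 3 → A}
    (hc : Function.Injective c) (hW : (Finset.univ : Finset (Fin 3)).val.map c ∈ W) {N : ℕ}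
    (hN : ∀ m ≤ N, ¬ H.HasCycle m) {X : Type*} [DecidableEq X] {p q : AiTerm X}
    (hpq : Satisfies (Sc W) p q)
    (hcard : (p.vars ∪ q.vars).card ≤ N) (f : X → H.Model) (h : p.eval f = top) :
    q.eval f = top := by
  classical
  -- Variables outside the identity are sent to `inf`, whose support is empty, so that all values
  -- are supported in `U`. Each used variable contributes at most one vertex to `U`.
  set f' : X → H.Model := fun x => if x ∈ p.vars ∪ q.vars then f x else inf
  have hp : p.eval f = p.eval f' := AiTerm.eval_congr fun x hx => by simp [f', hx]
  have hq : q.eval f = q.eval f' := AiTerm.eval_congr fun x hx => by simp [f', hx]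
  rw [hp] at h
  rw [hq]
  set U := (p.vars ∪ q.vars).biUnion fun x => (f x).supp
  have hU : U.card ≤ N :=
    (Finset.card_biUnion_le_card_mul _ _ 1 fun x _ => card_supp_le _).trans (by simpa using hcard)
  have hfU : ∀ x, (f' x).supp ⊆ U := by
    intro x
    by_cases hx : x ∈ p.vars ∪ q.vars
    · rw [show f' x = f x from if_pos hx]
      exact Finset.subset_biUnion_of_mem (fun x => (f x).supp) hx
    · rw [show f' x = inf from if_neg hx]
      exact Finset.empty_subset _
  have hF : IsForest (H.edges.filter (· ⊆ U)) := H.isForest_filter U fun m hm => hN m (hm.trans hU)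
  have htop : (top : H.Model) ≠ inf := fun h => by cases h
  have hn : Sc.ofMultiset W ((Finset.univ : Finset (Fin 3)).val.map c) ≠ Sc.zero :=
    Sc.ofMultiset_ne_zero (by simp) hW
  have key := fun x l =>
    lift_eq_top_iff hF (fun e => Finset.mem_filter) f' hfU x l
  rw [isFlatTop_inf.eval_eq_iff f' _ htop] at h ⊢
  rintro ⟨x, l⟩ hw
  refine (key x l).mpr fun φ hφ => ?_
  -- For a fixed colouring: all words of `p` become `abc`, so `p` does, so by the identity `q` does,
  -- and so does each of its words.
  refine (lift_ofMultiset_code_eq_iff hc hW f' φ x l).mp ?_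
  refine (Sc.isFlatTop_zero.eval_eq_iff _ q hn).mp ?_ _ hw
  rw [← hpq, Sc.isFlatTop_zero.eval_eq_iff _ p hn]
  rintro ⟨y, m⟩ hw'
  exact (lift_ofMultiset_code_eq_iff hc hW f' φ y m).mpr ((key y m).mp (h _ hw') φ hφ)

/-- An element other than `inf` is `top` or has a partner with product `top`, which determines it:
`one v` and `two v` are partners. This uses that the model contains `two v` for every vertex, even
one on no hyperedge. -/
theorem eq_of_mul_eq_top {x y : H.Model} (hx : x ≠ inf) (h1 : x = top → y = top)
    (h2 : ∀ z, x * z = top → y * z = top) : x = y := by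
  rcases x with _ | v | v | _
  · exact absurd rfl hx
  · obtain ⟨w, ⟨h3, h4⟩ | ⟨-, h4⟩⟩ := mul_eq_top (h2 (two v) (by rw [one_mul_two, if_pos rfl]))
    · rw [h3, two.inj h4]
    · cases h4
  · obtain ⟨w, ⟨-, h4⟩ | ⟨h3, h4⟩⟩ := mul_eq_top (h2 (one v) (by rw [two_mul_one, if_pos rfl]))
    · cases h4
    · rw [h3, one.inj h4]
  · exact (h1 rfl).symm

/-- The model of a hypergraph without short cycles satisfies the identities of `S_c(abc)` in few
variables. -/
theorem satisfies_of_satisfies {A : Type v} {W : Set (Multiset A)} {c : Fin 3 → A}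
    (hc : Function.Injective c) (hW : (Finset.univ : Finset (Fin 3)).val.map c ∈ W) {N : ℕ}
    (hN : ∀ m ≤ N, ¬ H.HasCycle m) {X : Type*} [DecidableEq X] {p q : AiTerm X}
    (hpq : Satisfies (Sc W) p q)
    (hcard : (p.vars ∪ q.vars).card + 1 ≤ N) : Satisfies H.Model p q := by
  intro f
  have h1 : ∀ {p q : AiTerm X}, Satisfies (Sc W) p q → (p.vars ∪ q.vars).card + 1 ≤ N →
      p.eval f = top → q.eval f = top := fun hpq hcard =>
    eval_eq_top_of_satisfies hc hW hN hpq (by omega) f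
  have h2 : ∀ {p q : AiTerm X}, Satisfies (Sc W) p q → (p.vars ∪ q.vars).card + 1 ≤ N →
      ∀ z, p.eval f * z = top → q.eval f * z = top := by
    intro p q hpq hcard z h
    -- Multiplication by `z` is encoded by a fresh variable `none`; this accounts for the `+ 1` in
    -- the bound.
    have h3 : Satisfies (Sc W) ((p.rename some).mul (.var none))
        ((q.rename some).mul (.var none)) := fun g => by
      simp only [AiTerm.eval, AiTerm.eval_rename, hpq (g ∘ some)]
    have h4 : ∀ r : AiTerm X, ((r.rename some).mul (.var none)).eval (fun o => Option.elim o z f) =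
        r.eval f * z := fun r => by
      simp only [AiTerm.eval, AiTerm.eval_rename]
      rfl
    rw [← h4] at h ⊢
    refine eval_eq_top_of_satisfies hc hW hN h3 (le_trans ?_ hcard) _ h
    calc _ ≤ (insert none ((p.vars ∪ q.vars).image some)).card := by
          apply Finset.card_le_card
          intro o
          simp only [AiTerm.vars, AiTerm.vars_rename, Finset.mem_union, Finset.mem_insert,
            Finset.mem_image, Finset.mem_singleton]
          grind
      _ ≤ ((p.vars ∪ q.vars).image some).card + 1 := Finset.card_insert_le _ _
      _ ≤ (p.vars ∪ q.vars).card + 1 := Nat.add_le_add_right Finset.card_image_le 1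
  by_cases hp : p.eval f = inf
  · by_cases hq : q.eval f = inf
    · rw [hp, hq]
    · have hpq' : Satisfies (Sc W) q p := fun g => (hpq g).symm
      rw [Finset.union_comm] at hcard
      exact (eq_of_mul_eq_top hq (h1 hpq' hcard) (h2 hpq' hcard)).symm
  · exact eq_of_mul_eq_top hp (h1 hpq hcard) (h2 hpq hcard)

end Model

/-! ### Comparison with the hypergraph semiring -/

namespace HypSemiring

variable {V : Type u} {H : Hypergraph3 V}

theorem gen_mul_gen_eq {x₁ x₂ y₁ y₂ z : V} (hx : H.IsEdge x₁ x₂ z) (hy : H.IsEdge y₁ y₂ z) :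
    (gen x₁ * gen x₂ : H.HypSemiring) = gen y₁ * gen y₂ :=
  (Con.eq _).mpr (ConGen.Rel.of _ _ (Rel.link x₁ x₂ y₁ y₂ z hx hy))

theorem gen_mul_gen_mul_gen_eq {x₁ x₂ x₃ y₁ y₂ y₃ : V} (hx : H.IsEdge x₁ x₂ x₃)
    (hy : H.IsEdge y₁ y₂ y₃) :
    (gen x₁ * gen x₂ * gen x₃ : H.HypSemiring) = gen y₁ * gen y₂ * gen y₃ :=
  (Con.eq _).mpr (ConGen.Rel.of _ _ (Rel.edge x₁ x₂ x₃ y₁ y₂ y₃ hx hy))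

theorem add_self (x : H.HypSemiring) : x + x = x := if_pos rfl

/-- A value other than `inf` in the model arises by steps that the defining relations also justify
in the presented semigroup. Hence value `top` gives value `a` there, which a non-hyperedge term
excludes; that the presentation does not collapse need not be shown. -/
theorem eval_gen [Fact H.IsLinear] (w : AiTerm V) :
    (∀ v, w.eval (Model.one : V → H.Model) = .one v → w.eval gen = (gen v : H.HypSemiring)) ∧
    (∀ z, w.eval (Model.one : V → H.Model) = .two z →
      ∃ x y, H.IsEdge x y z ∧ w.eval gen = (gen x * gen y : H.HypSemiring)) ∧
    (w.eval (Model.one : V → H.Model) = .top →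
      ∃ x y z, H.IsEdge x y z ∧ w.eval gen = (gen x * gen y * gen z : H.HypSemiring)) := by
  induction w with
  | var x =>
    refine ⟨fun v h => ?_, fun z h => ?_, fun h => ?_⟩
    · rw [AiTerm.eval, Model.one.inj h]
    · cases h
    · cases h
  | add p q hp hq =>
    obtain ⟨hp1, hp2, hp3⟩ := hp
    obtain ⟨hq1, hq2, hq3⟩ := hq
    simp only [AiTerm.eval]
    refine ⟨fun v h => ?_, fun z h => ?_, fun h => ?_⟩
    · rw [Model.isFlatTop_inf.add_eq_iff (fun h => by cases h)] at h
      rw [hp1 v h.1, hq1 v h.2, add_self]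
    · rw [Model.isFlatTop_inf.add_eq_iff (fun h => by cases h)] at h
      obtain ⟨x, y, he, h1⟩ := hp2 z h.1
      obtain ⟨x', y', he', h2⟩ := hq2 z h.2
      exact ⟨x, y, he, by rw [h1, h2, gen_mul_gen_eq he' he, add_self]⟩
    · rw [Model.isFlatTop_inf.add_eq_iff (fun h => by cases h)] at h
      obtain ⟨x, y, z, he, h1⟩ := hp3 h.1
      obtain ⟨x', y', z', he', h2⟩ := hq3 h.2
      exact ⟨x, y, z, he, by rw [h1, h2, gen_mul_gen_mul_gen_eq he' he, add_self]⟩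
  | mul p q hp hq =>
    obtain ⟨hp1, hp2, -⟩ := hp
    obtain ⟨hq1, hq2, -⟩ := hq
    simp only [AiTerm.eval]
    refine ⟨fun v h => absurd h (Model.mul_ne_one _ _ v), fun z h => ?_, fun h => ?_⟩
    · obtain ⟨u, v, h1, h2, he⟩ := Model.mul_eq_two h
      exact ⟨u, v, he, by rw [hp1 u h1, hq1 v h2]⟩
    · obtain ⟨v, ⟨h1, h2⟩ | ⟨h1, h2⟩⟩ := Model.mul_eq_top h
      · obtain ⟨x, y, he, h3⟩ := hq2 v h2
        exact ⟨v, x, y, he.rotate.rotate, by rw [hp1 v h1, h3, mul_assoc]⟩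
      · obtain ⟨x, y, he, h3⟩ := hp2 v h1
        exact ⟨x, y, v, he, by rw [h3, hq1 v h2]⟩

end HypSemiring

theorem IsNonHyperedgeTerm.eval_one_ne_top {V : Type u} {H : Hypergraph3 V} [Fact H.IsLinear]
    {w : AiTerm V} (hw : H.IsNonHyperedgeTerm w) :
    w.eval (Model.one : V → H.Model) ≠ .top := by
  intro h
  obtain ⟨x, y, z, he, h1⟩ := (HypSemiring.eval_gen w).2.2 h
  exact hw x y z he h1

theorem eval_term_one {V : Type u} [Fintype V] {H : Hypergraph3 V} [Fact H.IsLinear]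
    (h : H.edges.Nonempty) : (H.term h).eval (Model.one : V → H.Model) = .top := by
  classical
  refine AiTerm.eval_sum _ _ fun p hp => ?_
  simp only [hyperedgeProducts, List.mem_map, Finset.mem_toList, Finset.mem_filter] at hp
  obtain ⟨⟨x, y, z⟩, ⟨-, he⟩, rfl⟩ := hp
  exact (Model.one_mul_one_mul_one x y z).trans (if_pos he)

/-- In a flat semiring `t + w = a` with `a ≠ ∞` would force `w` to have the value `a` as well. -/
theorem not_satisfies_model {V : Type u} [Fintype V] {H : Hypergraph3 V} [Fact H.IsLinear]
    (h : H.edges.Nonempty) {w : AiTerm V} (hw : H.IsNonHyperedgeTerm w) :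
    ¬ Satisfies H.Model (H.term h) ((H.term h).add w) := by
  intro h1
  have h2 := h1 Model.one
  rw [AiTerm.eval, eval_term_one, eq_comm,
    Model.isFlatTop_inf.add_eq_iff (fun h => by cases h)] at h2
  exact hw.eval_one_ne_top h2.2

theorem not_hasCycle_of_lt_girth {V : Type u} {H : Hypergraph3 V} {m : ℕ}
    (h : (m : ℕ∞) < H.girth) : ¬ H.HasCycle m :=
  fun h1 => absurd (iInf₂_le m h1) (not_le.mpr h)

end Hypergraph3

/-! ### Finite bases and the contradiction -/

/-- If `K` is finitely based, then the models of some finite set of identities of `K` satisfy all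
identities of `K`. -/
theorem IsFinitelyBased.exists_finite_forall_satisfies
    {K : (S : Type u) → [AiSemiring S] → Prop} (hK : IsFinitelyBased K) :
    ∃ Γ : Set (AiTerm ℕ × AiTerm ℕ), Γ.Finite ∧ (∀ g ∈ Γ, ClassSatisfies K g.1 g.2) ∧
      ∀ (S : Type u) [AiSemiring S] [Nonempty S], (∀ g ∈ Γ, Satisfies S g.1 g.2) →
        ∀ (X : Type v) [Finite X] (p q : AiTerm X), ClassSatisfies K p q → Satisfies S p q := by
  obtain ⟨Γ, hΓ, h⟩ := hK
  refine ⟨Γ, hΓ, fun g hg => (h g.1 g.2).mpr fun S _ hS => hS g hg, ?_⟩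
  intro S _ _ hS X _ p q hpq f
  obtain ⟨g, hg⟩ := Countable.exists_injective_nat X
  have h1 : ClassSatisfies K (p.rename g) (q.rename g) := fun T _ hT f' => by
    rw [AiTerm.eval_rename, AiTerm.eval_rename]
    exact hpq T hT _
  -- The value `s` is a default for the variables outside the image of the renaming.
  obtain ⟨s⟩ := ‹Nonempty S›
  have h2 := (h _ _).mp h1 S hS (Function.extend g f fun _ => s)
  rwa [AiTerm.eval_rename, AiTerm.eval_rename, Function.extend_comp hg] at h2

theorem mainTheorem3
    (K : (S : Type u) → [AiSemiring S] → Prop) (hK : IsAiVariety K)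
    {A : Type u} (a b c : A) (hab : a ≠ b) (hac : a ≠ c) (hbc : b ≠ c)
    (habc : K (Sc {({a, b, c} : Multiset A)}))
    (V : ℕ → Type u) [∀ n, Fintype (V n)] (H : ∀ n, Hypergraph3 (V n))
    (hcol : ∀ n, 2 ≤ n → ¬ (H n).TwoColourable)
    (hgirth : ∀ n, 2 ≤ n → ((3 * (3 * n).choose 2 : ℕ) : ℕ∞) < (H n).girth)
    (w : ∀ n, AiTerm (V n))
    (hw : ∀ n, 2 ≤ n → (H n).IsNonHyperedgeTerm (w n))
    (hid : ∀ n, ∀ hn : 2 ≤ n,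
      ClassSatisfies K ((H n).term (Hypergraph3.edges_nonempty (hcol n hn)))
        (((H n).term (Hypergraph3.edges_nonempty (hcol n hn))).add (w n))) :
    ¬ IsFinitelyBased K := by
  intro hfb
  obtain ⟨Γ, hΓ, hKΓ, hmod⟩ := hfb.exists_finite_forall_satisfies
  obtain ⟨N, hN2, hN⟩ : ∃ N, 2 ≤ N ∧ ∀ g ∈ Γ, (g.1.vars ∪ g.2.vars).card + 1 ≤ N := by
    refine ⟨(hΓ.toFinset.sup fun g => (g.1.vars ∪ g.2.vars).card) + 2, by omega, fun g hg => ?_⟩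
    have := Finset.le_sup (f := fun g : AiTerm ℕ × AiTerm ℕ => (g.1.vars ∪ g.2.vars).card)
      (hΓ.mem_toFinset.mpr hg)
    omega
  have hcyc : ∀ m ≤ N, ¬ (H N).HasCycle m := fun m hm => by
    refine Hypergraph3.not_hasCycle_of_lt_girth (lt_of_le_of_lt ?_ (hgirth N hN2))
    -- By Pascal's rule `(k + 1).choose 2 ≥ k`, and here `k = 3 * N - 1 ≥ N`.
    have h1 : N ≤ (3 * N).choose 2 := by
      obtain ⟨k, hk⟩ : ∃ k, 3 * N = k + 1 := ⟨3 * N - 1, by omega⟩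
      rw [hk, Nat.choose_succ_succ' k 1, Nat.choose_one_right]
      omega
    exact_mod_cast (by omega : m ≤ 3 * (3 * N).choose 2)
  have : Fact (H N).IsLinear := ⟨Hypergraph3.isLinear_of_not_hasCycle (hcyc 2 hN2)⟩
  have hc : Function.Injective ![a, b, c] := by
    intro i j hij
    fin_cases i <;> fin_cases j <;> simp_all
  have : Nonempty (H N).Model := ⟨.inf⟩
  refine Hypergraph3.not_satisfies_model (Hypergraph3.edges_nonempty (hcol N hN2)) (hw N hN2)
    (hmod (H N).Model (fun g hg => ?_) (V N) _ _ (hid N hN2))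
  refine Hypergraph3.Model.satisfies_of_satisfies hc ?_ hcyc (hKΓ g hg _ habc) (hN g hg)
  rw [Set.mem_singleton_iff]
  rfl
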